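/- Theorem ($L^\infty$ bounds). Let $n\ge 2$, $p,q\in(0,\infty]$ with $p>n/2$ and $q>n$, let $0<r<R\le 1$, and let $0<\lambda\le\Lambda$, $L>0$; write $B_\rho=\{x\in\mathbb R^n: |x|<\rho\}$. Then there is a constant $C>0$, depending only on $n,p,q,r,R,\lambda,\Lambda,L$, such that the following holds. Let $A=(a_{ij})_{i,j=1}^n$ be a measurable (not necessarily symmetric) real matrix field on $B_R$ such that, for almost every $x\in B_R$, $|a_{ij}(x)|\le L$ for all $i,j$ and $$\lambda|\xi|^2\le A(x)\xi\cdot\xi\le\Lambda|\xi|^2\qquad\text{for all }\xi\in\mathbb R^n .$$ Let $f\in L^p(B_R)$ and $F\in L^q(B_R;\mathbb R^n)$. If $u\in H^1(B_R)$ is a weak solution of $-\mathrm{div}(A\nabla u)=f+\mathrm{div}F$ in $B_R$, that is, $$\int_{B_R}A\nabla u\cdot\nabla v=\int_{B_R}fv-\int_{B_R}F\cdot\nabla v\qquad\text{for all }v\in H^1_0(B_R),$$ where $H^1_0(B_R)$ is the closure of $C_c^\infty(B_R)$ in $H^1(B_R)$, then $$\|u\|_{L^\infty(B_r)}\le C\left(\|u\|_{L^2(B_R)}+\|f\|_{L^p(B_R)}+\|F\|_{L^q(B_R)}\right).$$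 -/

import Mathlib

open MeasureTheory Filter Topology
open scoped ENNReal ContDiff Matrix

/-- `φ ∈ C_c^∞(Ω)`. -/
def IsTestFunction {n : ℕ} (Ω : Set (EuclideanSpace ℝ (Fin n)))
    (φ : EuclideanSpace ℝ (Fin n) → ℝ) : Prop :=
  ContDiff ℝ ∞ φ ∧ HasCompactSupport φ ∧ tsupport φ ⊆ Ω

/-- `u ∈ H¹(Ω)` with weak gradient `G`: both are square integrable on `Ω`, and
`∫_Ω u ∂ᵢφ = - ∫_Ω Gᵢ φ` for all `φ ∈ C_c^∞(Ω)` and all `i`. -/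
structure HasH1Gradient {n : ℕ} (Ω : Set (EuclideanSpace ℝ (Fin n)))
    (u : EuclideanSpace ℝ (Fin n) → ℝ)
    (G : EuclideanSpace ℝ (Fin n) → EuclideanSpace ℝ (Fin n)) : Prop where
  memLp : MemLp u 2 (volume.restrict Ω)
  memLp_grad : MemLp G 2 (volume.restrict Ω)
  integral_eq : ∀ φ : EuclideanSpace ℝ (Fin n) → ℝ, IsTestFunction Ω φ → ∀ i : Fin n,
    ∫ x in Ω, u x * gradient φ x i = - ∫ x in Ω, G x i * φ x

/-- `v ∈ H¹₀(Ω)` with weak gradient `V`, where `H¹₀(Ω)` is the closure of `C_c^∞(Ω)` in the norm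
of `H¹(Ω)`. -/
structure HasH10Gradient {n : ℕ} (Ω : Set (EuclideanSpace ℝ (Fin n)))
    (v : EuclideanSpace ℝ (Fin n) → ℝ)
    (V : EuclideanSpace ℝ (Fin n) → EuclideanSpace ℝ (Fin n)) : Prop where
  hasH1Gradient : HasH1Gradient Ω v V
  exists_approx : ∃ φ : ℕ → EuclideanSpace ℝ (Fin n) → ℝ,
    (∀ k, IsTestFunction Ω (φ k)) ∧
    Tendsto (fun k => eLpNorm (fun x => φ k x - v x) 2 (volume.restrict Ω)) atTop (𝓝 0) ∧
    Tendsto (fun k => eLpNorm (fun x => gradient (φ k) x - V x) 2 (volume.restrict Ω))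
      atTop (𝓝 0)

/-- The matrix field `A` (not necessarily symmetric) is measurable on `Ω`, uniformly elliptic,
`lam |ξ|² ≤ A(x) ξ · ξ ≤ Lam |ξ|²`, and bounded, with entries at most `L` in absolute value,
for almost every `x ∈ Ω`. -/
structure IsUniformlyElliptic {n : ℕ} (Ω : Set (EuclideanSpace ℝ (Fin n)))
    (A : EuclideanSpace ℝ (Fin n) → Matrix (Fin n) (Fin n) ℝ) (lam Lam L : ℝ) : Prop where
  aemeasurable : ∀ i j, AEMeasurable (fun x => A x i j) (volume.restrict Ω)
  elliptic : ∀ᵐ x ∂(volume.restrict Ω), ∀ ξ : EuclideanSpace ℝ (Fin n),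
    lam * ‖ξ‖ ^ 2 ≤ (A x *ᵥ ξ.ofLp) ⬝ᵥ ξ.ofLp ∧ (A x *ᵥ ξ.ofLp) ⬝ᵥ ξ.ofLp ≤ Lam * ‖ξ‖ ^ 2
  bounded : ∀ᵐ x ∂(volume.restrict Ω), ∀ i j, |A x i j| ≤ L

/-- `u ∈ H¹(Ω)` is a weak solution of `-div(A∇u) = f + div F` in `Ω`: for all `v ∈ H¹₀(Ω)`,
`∫_Ω A∇u · ∇v = ∫_Ω f v - ∫_Ω F · ∇v`. -/
def IsWeakSolution {n : ℕ} (Ω : Set (EuclideanSpace ℝ (Fin n)))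
    (A : EuclideanSpace ℝ (Fin n) → Matrix (Fin n) (Fin n) ℝ)
    (f : EuclideanSpace ℝ (Fin n) → ℝ)
    (F : EuclideanSpace ℝ (Fin n) → EuclideanSpace ℝ (Fin n))
    (u : EuclideanSpace ℝ (Fin n) → ℝ) : Prop :=
  ∃ G : EuclideanSpace ℝ (Fin n) → EuclideanSpace ℝ (Fin n), HasH1Gradient Ω u G ∧
    ∀ v V, HasH10Gradient Ω v V →
      ∫ x in Ω, (A x *ᵥ (G x).ofLp) ⬝ᵥ (V x).ofLp =
        (∫ x in Ω, f x * v x) - ∫ x in Ω, inner ℝ (F x) (V x)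

/-!
The proof is De Giorgi's. Let `u` be a weak solution and `k` a level. Testing the equation with
`η² (u - k)⁺`, where `η` is a cutoff function, and absorbing the mixed terms by Young's inequality
gives a Caccioppoli inequality (`caccioppoli`) for the truncation `(u - k)⁺`. Together with the
Sobolev inequality for `η (u - k)⁺` and Hölder's inequality on the level set `{u > k}` it yields an
estimate on concentric balls in which the measure of the level set carries a power with the gain
`α = 1 / n - 1 / q > 0` (`exists_levelSet_estimate`). By Chebyshev's inequality that measure is
controlled by the `L²` norm of the truncation at a lower level, so that along levels increasing to
`K M` and radii decreasing to `r` the squared `L²` norms satisfy a superlinear recursion and tend to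
zero (`exists_deGiorgi_level`); here `M` bounds the norms of `u`, `f` and `F`, and `K` is a constant.
Hence `u ≤ K M` almost everywhere on the smaller ball (`exists_ae_le_of_isWeakSolution`), and the
same applies to `-u`.

The integrability exponents are first lowered to a single finite `q₀ > n` with `q₀ ≤ q` and
`q₀ / 2 ≤ p`, so that `f` and `F` contribute the same condition on exponents. The Sobolev inequality
is used with a subcritical exponent, which the strict inequality `n < q₀` permits; this treats
dimension two together with the others.

That `ζ (u - k)⁺` belongs to `H¹₀` for every test function `ζ`, with the expected gradient, is
`HasH1Gradient.hasH10Gradient_mul_truncation`. It rests on the approximation of `u` by its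
mollifications on compact sets (`HasH1Gradient.exists_contDiff_approx`), on the chain rule for smooth
functions of `u` (`HasH1Gradient.hasH10Gradient_mul_comp`) and on a smooth approximation of the
positive part whose derivative vanishes on `(-∞, 0]`.
-/

/-! ### Gradients and mollification in `L²` -/

theorem gradient_apply {n : ℕ} (φ : EuclideanSpace ℝ (Fin n) → ℝ) (x : EuclideanSpace ℝ (Fin n))
    (i : Fin n) : gradient φ x i = fderiv ℝ φ x (EuclideanSpace.single i 1) := by
  rw [← inner_gradient_left, EuclideanSpace.inner_single_right]
  simp

theorem HasGradientAt.mul {E : Type*} [NormedAddCommGroup E] [InnerProductSpace ℝ E]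
    [CompleteSpace E] {f g : E → ℝ} {f' g' x : E} (hf : HasGradientAt f f' x)
    (hg : HasGradientAt g g' x) :
    HasGradientAt (fun x => f x * g x) (f x • g' + g x • f') x := by
  rw [hasGradientAt_iff_hasFDerivAt] at *
  convert! hf.mul hg using 1
  simp

theorem HasDerivAt.comp_hasGradientAt {E : Type*} [NormedAddCommGroup E] [InnerProductSpace ℝ E]
    [CompleteSpace E] {f : E → ℝ} {f' x : E} {Φ : ℝ → ℝ} {c : ℝ} (hΦ : HasDerivAt Φ c (f x))
    (hf : HasGradientAt f f' x) : HasGradientAt (fun x => Φ (f x)) (c • f') x := by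
  rw [hasGradientAt_iff_hasFDerivAt] at *
  convert! hΦ.comp_hasFDerivAt x hf using 1
  simp

theorem ContDiff.continuous_gradient {E : Type*} [NormedAddCommGroup E] [InnerProductSpace ℝ E]
    [CompleteSpace E] {f : E → ℝ} (hf : ContDiff ℝ ∞ f) : Continuous (gradient f) :=
  (InnerProductSpace.toDual ℝ E).symm.continuous.comp (hf.continuous_fderiv (by simp))

theorem ContDiff.hasGradientAt {E : Type*} [NormedAddCommGroup E] [InnerProductSpace ℝ E]
    [CompleteSpace E] {f : E → ℝ} (hf : ContDiff ℝ ∞ f) (x : E) :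
    HasGradientAt f (gradient f x) x :=
  (hf.differentiable (by simp) x).hasGradientAt

theorem eLpNorm_two_sq {α F : Type*} [MeasurableSpace α] [NormedAddCommGroup F] (μ : Measure α)
    (f : α → F) : eLpNorm f 2 μ ^ 2 = ∫⁻ x, ‖f x‖ₑ ^ 2 ∂μ := by
  rw [eLpNorm_eq_lintegral_rpow_enorm_toReal (by simp) (by simp), ← ENNReal.rpow_natCast,
    ← ENNReal.rpow_mul]
  simp

/-- Dominated convergence in `L²`. -/
theorem tendsto_eLpNorm_two_of_dominated {α F : Type*} [MeasurableSpace α] [NormedAddCommGroup F]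
    {μ : Measure α} {f : ℕ → α → F} {b : α → ℝ} (hf : ∀ k, AEStronglyMeasurable (f k) μ)
    (hb : MemLp b 2 μ) (hfb : ∀ k, ∀ᵐ x ∂μ, ‖f k x‖ ≤ b x)
    (hlim : ∀ᵐ x ∂μ, Tendsto (fun k => f k x) atTop (𝓝 0)) :
    Tendsto (fun k => eLpNorm (f k) 2 μ) atTop (𝓝 0) := by
  have h : Tendsto (fun k => ∫⁻ x, ‖f k x‖ₑ ^ 2 ∂μ) atTop (𝓝 (∫⁻ _, 0 ∂μ)) := by
    refine tendsto_lintegral_of_dominated_convergence' (fun x => ‖b x‖ₑ ^ 2)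
      (fun k => (hf k).enorm.pow_const 2) (fun k => ?_) ?_ ?_
    · filter_upwards [hfb k] with x hx
      gcongr
      exact enorm_le_iff_norm_le.2 (hx.trans (le_abs_self _))
    · rw [← eLpNorm_two_sq]
      exact ENNReal.pow_ne_top hb.eLpNorm_ne_top
    · filter_upwards [hlim] with x hx
      have := (ENNReal.continuous_pow 2).tendsto _ |>.comp hx.enorm
      simpa [Function.comp_def] using this
  simp only [lintegral_zero, ← eLpNorm_two_sq] at h
  have h2 := (ENNReal.continuous_rpow_const (y := 1 / 2)).continuousAt.tendsto.comp h
  simp only [Function.comp_def, ← ENNReal.rpow_natCast, ← ENNReal.rpow_mul] at h2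
  simpa using h2

/-- Translations act continuously on `L²`. -/
theorem tendsto_eLpNorm_translate_sub {n : ℕ} {F : Type*} [NormedAddCommGroup F]
    {g : EuclideanSpace ℝ (Fin n) → F} (hg : MemLp g 2 volume) :
    Tendsto (fun y => eLpNorm (fun x => g (x - y) - g x) 2 volume) (𝓝 0) (𝓝 0) := by
  have : Fact ((2 : ℝ≥0∞) ≠ ⊤) := ⟨by simp⟩
  have hc : Continuous (fun y : EuclideanSpace ℝ (Fin n) =>
      DomAddAct.mk (-y) +ᵥ (hg.toLp g)) := by
    have : Continuous fun y : EuclideanSpace ℝ (Fin n) => DomAddAct.mk (-y) :=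
      DomAddAct.continuous_mk.comp continuous_neg
    exact this.vadd continuous_const
  have h1 : Tendsto (fun y : EuclideanSpace ℝ (Fin n) =>
      edist (DomAddAct.mk (-y) +ᵥ (hg.toLp g)) (hg.toLp g)) (𝓝 0) (𝓝 0) := by
    have := (hc.edist (continuous_const (y := hg.toLp g))).tendsto 0
    simpa using this
  refine h1.congr fun y => ?_
  rw [DomAddAct.mk_vadd_toLp, Lp.edist_toLp_toLp]
  congr 1
  ext x
  simp [sub_eq_neg_add]

/-- Minkowski's inequality for a mollification: it moves `g` in `L²` by no more than the
translations by the vectors in the support of the mollifier do. -/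
theorem eLpNorm_normed_convolution_sub_le {n : ℕ} {F : Type*} [NormedAddCommGroup F]
    [NormedSpace ℝ F] [CompleteSpace F] (φ : ContDiffBump (0 : EuclideanSpace ℝ (Fin n)))
    {g : EuclideanSpace ℝ (Fin n) → F} (hg : MemLp g 2 volume) (hgm : StronglyMeasurable g)
    {ε : ℝ≥0∞}
    (hε : ∀ y ∈ Metric.ball 0 φ.rOut, eLpNorm (fun x => g (x - y) - g x) 2 volume ≤ ε) :
    eLpNorm (fun x => convolution (φ.normed volume) g (ContinuousLinearMap.lsmul ℝ ℝ) volume x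
      - g x) 2 volume ≤ ε := by
  set ρ := φ.normed (volume : Measure (EuclideanSpace ℝ (Fin n))) with hρ
  have hρc : Continuous ρ := φ.continuous_normed
  have hone : ∫⁻ y, ‖ρ y‖ₑ = 1 := by
    have := φ.integral_normed (μ := (volume : Measure (EuclideanSpace ℝ (Fin n))))
    rw [← ofReal_integral_norm_eq_lintegral_enorm φ.integrable_normed]
    simp only [Real.norm_of_nonneg (φ.nonneg_normed _)]
    rw [this, ENNReal.ofReal_one]
  have hmeas : Measurable (fun z : EuclideanSpace ℝ (Fin n) × EuclideanSpace ℝ (Fin n) =>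
      ‖g (z.1 - z.2) - g z.1‖ₑ) :=
    ((hgm.comp_measurable (measurable_fst.sub measurable_snd)).sub
      (hgm.comp_measurable measurable_fst)).enorm
  have hpt : ∀ x, ‖convolution ρ g (ContinuousLinearMap.lsmul ℝ ℝ) volume x - g x‖ₑ ^ 2
      ≤ ∫⁻ y, ‖ρ y‖ₑ * ‖g (x - y) - g x‖ₑ ^ 2 := by
    intro x
    have h1 : convolution ρ g (ContinuousLinearMap.lsmul ℝ ℝ) volume x - g x
        = ∫ y, ρ y • (g (x - y) - g x) := by
      have hi : Integrable (fun y => ρ y • g (x - y)) volume :=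
        (HasCompactSupport.convolutionExists_left (ContinuousLinearMap.lsmul ℝ ℝ)
          φ.hasCompactSupport_normed hρc (hg.locallyIntegrable (by norm_num))) x
      simp_rw [smul_sub]
      rw [integral_sub hi (φ.integrable_normed.smul_const _), φ.integral_normed_smul]
      rfl
    have h2 : ‖∫ y, ρ y • (g (x - y) - g x)‖ₑ ≤ ∫⁻ y, ‖ρ y‖ₑ * ‖g (x - y) - g x‖ₑ := by
      refine (enorm_integral_le_lintegral_enorm _).trans_eq ?_
      simp only [enorm_smul]
    have hm : Measurable fun y => ‖g (x - y) - g x‖ₑ := hmeas.comp measurable_prodMk_left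
    -- Cauchy–Schwarz for the splitting `ρ = ρ ^ (1/2) * ρ ^ (1/2)`.
    have h3 := ENNReal.lintegral_mul_le_Lp_mul_Lq (volume : Measure (EuclideanSpace ℝ (Fin n)))
      Real.HolderConjugate.two_two
      (f := fun y => ‖ρ y‖ₑ ^ (1 / 2 : ℝ)) (g := fun y => ‖ρ y‖ₑ ^ (1 / 2 : ℝ) *
        ‖g (x - y) - g x‖ₑ) (hρc.measurable.enorm.pow_const _).aemeasurable
      ((hρc.measurable.enorm.pow_const _).mul hm).aemeasurable
    have hhalf : ∀ a : ℝ≥0∞, a ^ (1 / 2 : ℝ) * a ^ (1 / 2 : ℝ) = a := fun a => by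
      rw [← ENNReal.rpow_add_of_nonneg _ _ (by norm_num) (by norm_num)]; norm_num
    have hsq : ∀ a : ℝ≥0∞, (a ^ (1 / 2 : ℝ)) ^ 2 = a := fun a => by
      rw [pow_two, hhalf]
    simp only [Pi.mul_apply, ← mul_assoc, hhalf] at h3
    rw [h1]
    refine (pow_le_pow_left₀ (zero_le) (h2.trans h3) 2).trans_eq ?_
    rw [mul_pow, hsq, hsq]
    simp only [ENNReal.rpow_two, mul_pow, hsq, hone, one_mul]
  have hsq : eLpNorm (fun x => convolution ρ g (ContinuousLinearMap.lsmul ℝ ℝ) volume x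
      - g x) 2 volume ^ 2 ≤ ε ^ 2 := by
    rw [eLpNorm_two_sq]
    calc _ ≤ ∫⁻ x, ∫⁻ y, ‖ρ y‖ₑ * ‖g (x - y) - g x‖ₑ ^ 2 := lintegral_mono hpt
      _ = ∫⁻ y, ∫⁻ x, ‖ρ y‖ₑ * ‖g (x - y) - g x‖ₑ ^ 2 :=
        lintegral_lintegral_swap
          (((hρc.measurable.comp measurable_snd).enorm).mul (hmeas.pow_const 2)).aemeasurable
      _ ≤ ∫⁻ y, ‖ρ y‖ₑ * ε ^ 2 := by
        refine lintegral_mono fun y => ?_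
        have hm : Measurable fun x => ‖g (x - y) - g x‖ₑ := hmeas.comp measurable_prodMk_right
        dsimp only
        rw [lintegral_const_mul _ (hm.pow_const 2), ← eLpNorm_two_sq]
        by_cases hy : y ∈ Metric.ball 0 φ.rOut
        · gcongr
          exact hε y hy
        · have : ρ y = 0 := by
            rw [← φ.support_normed_eq (μ := volume)] at hy
            simpa using hy
          simp [this]
      _ = ε ^ 2 := by
        rw [lintegral_mul_const _ hρc.measurable.enorm, hone, one_mul]
  exact (ENNReal.pow_le_pow_left_iff two_ne_zero).1 hsq

/-- Interior form of the Meyers–Serrin theorem: over a compact subset of `Ω` an `H¹(Ω)` function is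
an `H¹` limit of smooth functions, namely of its mollifications. -/
theorem HasH1Gradient.exists_contDiff_approx {n : ℕ} {Ω K : Set (EuclideanSpace ℝ (Fin n))}
    {u : EuclideanSpace ℝ (Fin n) → ℝ} {G : EuclideanSpace ℝ (Fin n) → EuclideanSpace ℝ (Fin n)}
    (h : HasH1Gradient Ω u G) (hΩ : IsOpen Ω) (hK : IsCompact K) (hKΩ : K ⊆ Ω)
    (hu : StronglyMeasurable u) (hG : StronglyMeasurable G) :
    ∃ ψ : ℕ → EuclideanSpace ℝ (Fin n) → ℝ, (∀ k, ContDiff ℝ ∞ (ψ k)) ∧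
      Tendsto (fun k => eLpNorm (fun x => ψ k x - u x) 2 (volume.restrict K)) atTop (𝓝 0) ∧
      Tendsto (fun k => eLpNorm (fun x => gradient (ψ k) x - G x) 2 (volume.restrict K))
        atTop (𝓝 0) := by
  obtain ⟨δ, hδ, hδΩ⟩ := hK.exists_cthickening_subset_open hΩ hKΩ
  have hKm : MeasurableSet K := hK.measurableSet
  have hΩm : MeasurableSet Ω := hΩ.measurableSet
  set u₀ := Ω.indicator u with hu₀
  set G₀ := Ω.indicator G with hG₀
  have hu₀L : MemLp u₀ 2 volume := (memLp_indicator_iff_restrict hΩm).2 h.memLp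
  have hG₀L : MemLp G₀ 2 volume := (memLp_indicator_iff_restrict hΩm).2 h.memLp_grad
  let φ : ℕ → ContDiffBump (0 : EuclideanSpace ℝ (Fin n)) := fun k =>
    ⟨δ / (k + 2) / 2, δ / (k + 2), by positivity, half_lt_self (by positivity)⟩
  have hφout : ∀ k, (φ k).rOut = δ / (k + 2) := fun k => rfl
  have hφlim : Tendsto (fun k => (φ k).rOut) atTop (𝓝 0) := by
    simp only [hφout]
    exact tendsto_const_nhds.div_atTop
      (tendsto_atTop_add_const_right _ _ tendsto_natCast_atTop_atTop)
  have hφδ : ∀ k, (φ k).rOut < δ := fun k => by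
    rw [hφout, div_lt_iff₀ (by positivity)]
    nlinarith [(k.cast_nonneg : (0 : ℝ) ≤ k)]
  have key : ∀ {F : Type} [NormedAddCommGroup F] [NormedSpace ℝ F] [CompleteSpace F]
      {g : EuclideanSpace ℝ (Fin n) → F}, MemLp g 2 volume → StronglyMeasurable g →
      Tendsto (fun k => eLpNorm (fun x => convolution ((φ k).normed volume) g
        (ContinuousLinearMap.lsmul ℝ ℝ) volume x - g x) 2 volume) atTop (𝓝 0) := by
    intro F _ _ _ g hg hgm
    refine ENNReal.tendsto_nhds_zero.2 fun ε hε => ?_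
    obtain ⟨η, hη, hηε⟩ := Metric.eventually_nhds_iff.1
      (ENNReal.tendsto_nhds_zero.1 (tendsto_eLpNorm_translate_sub hg) ε hε)
    filter_upwards [hφlim.eventually (gt_mem_nhds hη)] with k hk
    refine eLpNorm_normed_convolution_sub_le (φ k) hg hgm fun y hy => hηε ?_
    exact (Metric.mem_ball.1 hy).trans hk
  have hu₀loc : LocallyIntegrable u₀ volume := hu₀L.locallyIntegrable (by norm_num)
  have hG₀loc : LocallyIntegrable G₀ volume := hG₀L.locallyIntegrable (by norm_num)
  refine ⟨fun k => convolution ((φ k).normed volume) u₀ (ContinuousLinearMap.lsmul ℝ ℝ) volume,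
    fun k => ?_, ?_, ?_⟩
  · exact HasCompactSupport.contDiff_convolution_left (n := ⊤) _ (φ k).hasCompactSupport_normed
      (φ k).contDiff_normed hu₀loc
  · refine tendsto_of_tendsto_of_tendsto_of_le_of_le tendsto_const_nhds
      (key hu₀L (hu.indicator hΩm)) (fun _ => zero_le) fun k => ?_
    refine le_trans (le_of_eq ?_) (eLpNorm_mono_measure _ (Measure.restrict_le_self (s := K)))
    refine eLpNorm_congr_ae ((ae_restrict_mem hKm).mono fun x hx => ?_)
    simp [hu₀, Set.indicator_of_mem (hKΩ hx)]
  · refine tendsto_of_tendsto_of_tendsto_of_le_of_le tendsto_const_nhds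
      (key hG₀L (hG.indicator hΩm)) (fun _ => zero_le) fun k => ?_
    refine le_trans (le_of_eq ?_) (eLpNorm_mono_measure _ (Measure.restrict_le_self (s := K)))
    refine eLpNorm_congr_ae ((ae_restrict_mem hKm).mono fun x hx => ?_)
    dsimp only
    rw [hG₀, Set.indicator_of_mem (hKΩ hx), ← hG₀]
    congr 1
    set ρ := (φ k).normed (volume : Measure (EuclideanSpace ℝ (Fin n))) with hρ
    have hρs : ContDiff ℝ ∞ ρ := (φ k).contDiff_normed
    have hρc : HasCompactSupport ρ := (φ k).hasCompactSupport_normed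
    ext i
    rw [gradient_apply, (HasCompactSupport.hasFDerivAt_convolution_left
      (ContinuousLinearMap.lsmul ℝ ℝ) hρc (hρs.of_le (by simp)) hu₀loc x).fderiv]
    -- The reflected mollifier `t ↦ ρ (x - t)` is an admissible test function near `K`.
    have htest : IsTestFunction Ω (fun t => ρ (x - t)) := by
      refine ⟨hρs.comp (contDiff_const.sub contDiff_id), ?_, ?_⟩
      · exact hρc.comp_homeomorph (Homeomorph.subLeft x)
      · refine (closure_minimal (t := Metric.closedBall x δ) ?_ Metric.isClosed_closedBall).trans
          ((Metric.closedBall_subset_cthickening hx δ).trans hδΩ)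
        intro t ht
        have : x - t ∈ Metric.ball (0 : EuclideanSpace ℝ (Fin n)) (φ k).rOut := by
          rw [← (φ k).support_normed_eq (μ := volume)]
          exact ht
        rw [mem_ball_zero_iff] at this
        rw [Metric.mem_closedBall, dist_comm, dist_eq_norm]
        exact (this.trans (hφδ k)).le
    have hgrad : ∀ t, gradient (fun t => ρ (x - t)) t i
        = - fderiv ℝ ρ (x - t) (EuclideanSpace.single i 1) := by
      intro t
      have h2 : HasFDerivAt (fun t => ρ (x - t)) ((fderiv ℝ ρ (x - t)).comp
          (-ContinuousLinearMap.id ℝ (EuclideanSpace ℝ (Fin n)))) t :=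
        ((hρs.differentiable (by simp) _).hasFDerivAt).comp t ((hasFDerivAt_id t).const_sub x)
      rw [gradient_apply, h2.fderiv]
      simp
    have hint := h.integral_eq _ htest i
    simp only [hgrad] at hint
    have hL : Integrable (fun t => (ContinuousLinearMap.precompL (EuclideanSpace ℝ (Fin n))
        (ContinuousLinearMap.lsmul ℝ ℝ) (fderiv ℝ ρ t)) (u₀ (x - t))) volume :=
      (HasCompactSupport.convolutionExists_left _ (hρc.fderiv (𝕜 := ℝ))
        (hρs.continuous_fderiv (by simp)) hu₀loc) x
    have hR : Integrable (fun t => ρ (x - t) • G₀ t) volume := by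
      have := (HasCompactSupport.convolutionExists_left (ContinuousLinearMap.lsmul ℝ ℝ)
        hρc hρs.continuous hG₀loc x).integrable_swap
      simpa using this
    have hLHS : (convolution (fderiv ℝ ρ) u₀ (ContinuousLinearMap.precompL
        (EuclideanSpace ℝ (Fin n)) (ContinuousLinearMap.lsmul ℝ ℝ)) volume x)
        (EuclideanSpace.single i 1)
        = ∫ t in Ω, u t * fderiv ℝ ρ (x - t) (EuclideanSpace.single i 1) := by
      rw [convolution_def, ContinuousLinearMap.integral_apply hL, ← integral_indicator hΩm,
        ← integral_sub_left_eq_self _ volume x]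
      refine integral_congr_ae (Eventually.of_forall fun t => ?_)
      by_cases ht : t ∈ Ω <;> simp [hu₀, ht, mul_comm]
    have hRHS : (convolution ρ G₀ (ContinuousLinearMap.lsmul ℝ ℝ) volume x) i
        = ∫ t in Ω, G t i * ρ (x - t) := by
      rw [convolution_lsmul_swap, ← integral_indicator hΩm]
      have := (EuclideanSpace.proj (𝕜 := ℝ) i : EuclideanSpace ℝ (Fin n) →L[ℝ] ℝ).integral_comp_comm
        hR
      refine this.symm.trans ?_
      refine integral_congr_ae (Eventually.of_forall fun t => ?_)
      by_cases ht : t ∈ Ω <;> simp [hG₀, ht, mul_comm]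
    rw [hLHS, hRHS]
    simp only [mul_neg, integral_neg, neg_inj] at hint
    exact hint

/-! ### The space `H¹₀` and the chain rule -/

theorem gradient_eq_zero_of_notMem_tsupport {n : ℕ} {φ : EuclideanSpace ℝ (Fin n) → ℝ}
    {x : EuclideanSpace ℝ (Fin n)} (hx : x ∉ tsupport φ) : gradient φ x = 0 := by
  rw [(notMem_tsupport_iff_eventuallyEq.1 hx).gradient_eq]
  exact gradient_fun_const x 0

theorem hasCompactSupport_gradient {n : ℕ} {φ : EuclideanSpace ℝ (Fin n) → ℝ}
    (h : HasCompactSupport φ) : HasCompactSupport (gradient φ) :=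
  HasCompactSupport.intro h fun _ hx => gradient_eq_zero_of_notMem_tsupport hx

theorem IsTestFunction.continuous {n : ℕ} {Ω : Set (EuclideanSpace ℝ (Fin n))}
    {φ : EuclideanSpace ℝ (Fin n) → ℝ} (h : IsTestFunction Ω φ) : Continuous φ :=
  h.1.continuous

theorem IsTestFunction.continuous_gradient {n : ℕ} {Ω : Set (EuclideanSpace ℝ (Fin n))}
    {φ : EuclideanSpace ℝ (Fin n) → ℝ} (h : IsTestFunction Ω φ) : Continuous (gradient φ) :=
  h.1.continuous_gradient

theorem IsTestFunction.memLp {n : ℕ} {Ω : Set (EuclideanSpace ℝ (Fin n))}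
    {φ : EuclideanSpace ℝ (Fin n) → ℝ} (h : IsTestFunction Ω φ) (p : ℝ≥0∞)
    (μ : Measure (EuclideanSpace ℝ (Fin n))) [IsFiniteMeasureOnCompacts μ] : MemLp φ p μ :=
  h.continuous.memLp_of_hasCompactSupport h.2.1

theorem IsTestFunction.memLp_gradient {n : ℕ} {Ω : Set (EuclideanSpace ℝ (Fin n))}
    {φ : EuclideanSpace ℝ (Fin n) → ℝ} (h : IsTestFunction Ω φ) (p : ℝ≥0∞)
    (μ : Measure (EuclideanSpace ℝ (Fin n))) [IsFiniteMeasureOnCompacts μ] :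
    MemLp (gradient φ) p μ :=
  h.continuous_gradient.memLp_of_hasCompactSupport (hasCompactSupport_gradient h.2.1)

theorem MeasureTheory.MemLp.euclideanSpace_apply {n : ℕ} {α : Type*} [MeasurableSpace α]
    {μ : Measure α} {p : ℝ≥0∞} {G : α → EuclideanSpace ℝ (Fin n)} (hG : MemLp G p μ) (i : Fin n) :
    MemLp (fun x => G x i) p μ :=
  hG.of_le ((EuclideanSpace.proj (𝕜 := ℝ) i).continuous.comp_aestronglyMeasurable
    hG.aestronglyMeasurable) (Eventually.of_forall fun x => PiLp.norm_apply_le (G x) i)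

theorem tendsto_eLpNorm_sub_apply {n : ℕ} {α : Type*} [MeasurableSpace α]
    {μ : Measure α} {p : ℝ≥0∞} {G : ℕ → α → EuclideanSpace ℝ (Fin n)}
    {H : α → EuclideanSpace ℝ (Fin n)}
    (h : Tendsto (fun k => eLpNorm (fun x => G k x - H x) p μ) atTop (𝓝 0)) (i : Fin n) :
    Tendsto (fun k => eLpNorm (fun x => G k x i - H x i) p μ) atTop (𝓝 0) :=
  tendsto_of_tendsto_of_tendsto_of_le_of_le tendsto_const_nhds h (fun _ => zero_le) fun k =>
    eLpNorm_mono fun x => PiLp.norm_apply_le (G k x - H x) i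

theorem tendsto_integral_mul_of_tendsto_eLpNorm_two {α : Type*} [MeasurableSpace α]
    {μ : Measure α} {f : ℕ → α → ℝ} {f₀ g : α → ℝ} (hf : ∀ k, MemLp (f k) 2 μ)
    (hf₀ : MemLp f₀ 2 μ) (hg : MemLp g 2 μ)
    (h : Tendsto (fun k => eLpNorm (fun x => f k x - f₀ x) 2 μ) atTop (𝓝 0)) :
    Tendsto (fun k => ∫ x, f k x * g x ∂μ) atTop (𝓝 (∫ x, f₀ x * g x ∂μ)) := by
  refine tendsto_integral_of_L1' _ (hf₀.integrable_mul hg).aestronglyMeasurable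
    (Eventually.of_forall fun k => (hf k).integrable_mul hg) ?_
  have h2 : Tendsto (fun k => eLpNorm (fun x => f k x - f₀ x) 2 μ * eLpNorm g 2 μ) atTop
      (𝓝 0) := by
    simpa using ENNReal.Tendsto.mul_const h (Or.inr hg.eLpNorm_ne_top)
  refine tendsto_of_tendsto_of_tendsto_of_le_of_le tendsto_const_nhds h2 (fun _ => zero_le)
    fun k => ?_
  refine le_trans (le_of_eq ?_) (eLpNorm_smul_le_mul_eLpNorm (r := 1) hg.aestronglyMeasurable
    ((hf k).sub hf₀).aestronglyMeasurable)
  congr 1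
  ext x
  simp [sub_mul]

theorem memLp_of_tendsto_eLpNorm_sub {α F : Type*} [MeasurableSpace α] [NormedAddCommGroup F]
    {μ : Measure α} {p : ℝ≥0∞} {f : ℕ → α → F} {f₀ : α → F} (hf : ∀ k, MemLp (f k) p μ)
    (hf₀ : AEStronglyMeasurable f₀ μ)
    (h : Tendsto (fun k => eLpNorm (fun x => f k x - f₀ x) p μ) atTop (𝓝 0)) : MemLp f₀ p μ := by
  obtain ⟨k, hk⟩ := (h.eventually (gt_mem_nhds ENNReal.zero_lt_top)).exists
  have : MemLp (f k - fun x => f k x - f₀ x) p μ :=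
    (hf k).sub ⟨(hf k).aestronglyMeasurable.sub hf₀, hk⟩
  convert! this using 1
  ext x
  simp

/-- A limit of test functions in the norm of `H¹(Ω)` belongs to `H¹₀(Ω)`: the weak gradient of the
limit is the limit of the gradients. -/
theorem hasH10Gradient_of_tendsto {n : ℕ} {Ω : Set (EuclideanSpace ℝ (Fin n))}
    {v : EuclideanSpace ℝ (Fin n) → ℝ} {V : EuclideanSpace ℝ (Fin n) → EuclideanSpace ℝ (Fin n)}
    (hv : AEStronglyMeasurable v (volume.restrict Ω))
    (hV : AEStronglyMeasurable V (volume.restrict Ω))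
    {φ : ℕ → EuclideanSpace ℝ (Fin n) → ℝ} (hφ : ∀ k, IsTestFunction Ω (φ k))
    (h : Tendsto (fun k => eLpNorm (fun x => φ k x - v x) 2 (volume.restrict Ω)) atTop (𝓝 0))
    (h' : Tendsto (fun k => eLpNorm (fun x => gradient (φ k) x - V x) 2 (volume.restrict Ω))
      atTop (𝓝 0)) : HasH10Gradient Ω v V := by
  have hvL : MemLp v 2 (volume.restrict Ω) :=
    memLp_of_tendsto_eLpNorm_sub (fun k => (hφ k).memLp 2 _) hv h
  have hVL : MemLp V 2 (volume.restrict Ω) :=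
    memLp_of_tendsto_eLpNorm_sub (fun k => (hφ k).memLp_gradient 2 _) hV h'
  refine ⟨⟨hvL, hVL, fun χ hχ i => ?_⟩, φ, hφ, h, h'⟩
  have h1 := tendsto_integral_mul_of_tendsto_eLpNorm_two (fun k => (hφ k).memLp 2 _) hvL
    ((hχ.memLp_gradient 2 (volume.restrict Ω)).euclideanSpace_apply i) h
  have h2 := tendsto_integral_mul_of_tendsto_eLpNorm_two
    (fun k => ((hφ k).memLp_gradient 2 _).euclideanSpace_apply i) (hVL.euclideanSpace_apply i)
    (hχ.memLp 2 (volume.restrict Ω)) (tendsto_eLpNorm_sub_apply h' i)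
  refine tendsto_nhds_unique h1 (h2.neg.congr fun k => ?_)
  have hout : ∀ x ∉ Ω, φ k x = 0 := fun x hx =>
    image_eq_zero_of_notMem_tsupport fun hx' => hx ((hφ k).2.2 hx')
  have hout' : ∀ x ∉ Ω, χ x = 0 := fun x hx =>
    image_eq_zero_of_notMem_tsupport fun hx' => hx (hχ.2.2 hx')
  rw [setIntegral_eq_integral_of_forall_compl_eq_zero (fun x hx => by simp [hout' x hx]),
    setIntegral_eq_integral_of_forall_compl_eq_zero (fun x hx => by simp [hout x hx])]
  simp only [gradient_apply]
  refine (integral_mul_fderiv_eq_neg_fderiv_mul_of_integrable ?_ ?_ ?_ ?_ ?_).symm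
  · exact (((hφ k).1.continuous_fderiv (by simp)).clm_apply continuous_const
      |>.mul hχ.continuous).integrable_of_hasCompactSupport hχ.2.1.mul_left
  · exact ((hφ k).continuous.mul ((hχ.1.continuous_fderiv (by simp)).clm_apply
      continuous_const)).integrable_of_hasCompactSupport (hφ k).2.1.mul_right
  · exact ((hφ k).continuous.mul hχ.continuous).integrable_of_hasCompactSupport
      (hφ k).2.1.mul_right
  · exact fun x _ => (hφ k).1.differentiable (by simp) x
  · exact fun x _ => hχ.1.differentiable (by simp) x

/-- `H¹₀(Ω)` is closed under convergence in `H¹(Ω)`. -/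
theorem HasH10Gradient.of_tendsto {n : ℕ} {Ω : Set (EuclideanSpace ℝ (Fin n))}
    {v : EuclideanSpace ℝ (Fin n) → ℝ} {V : EuclideanSpace ℝ (Fin n) → EuclideanSpace ℝ (Fin n)}
    (hv : AEStronglyMeasurable v (volume.restrict Ω))
    (hV : AEStronglyMeasurable V (volume.restrict Ω))
    {w : ℕ → EuclideanSpace ℝ (Fin n) → ℝ}
    {W : ℕ → EuclideanSpace ℝ (Fin n) → EuclideanSpace ℝ (Fin n)}
    (hw : ∀ k, HasH10Gradient Ω (w k) (W k))
    (h : Tendsto (fun k => eLpNorm (fun x => w k x - v x) 2 (volume.restrict Ω)) atTop (𝓝 0))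
    (h' : Tendsto (fun k => eLpNorm (fun x => W k x - V x) 2 (volume.restrict Ω))
      atTop (𝓝 0)) : HasH10Gradient Ω v V := by
  have hex : ∀ k : ℕ, ∃ φ, IsTestFunction Ω φ ∧
      eLpNorm (fun x => φ x - w k x) 2 (volume.restrict Ω) ≤ (k : ℝ≥0∞)⁻¹ ∧
      eLpNorm (fun x => gradient φ x - W k x) 2 (volume.restrict Ω) ≤ (k : ℝ≥0∞)⁻¹ := by
    intro k
    obtain ⟨φ, hφ, h1, h2⟩ := (hw k).exists_approx
    have hk : (0 : ℝ≥0∞) < (k : ℝ≥0∞)⁻¹ := by simp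
    obtain ⟨m, hm1, hm2⟩ :=
      ((h1.eventually (ge_mem_nhds hk)).and (h2.eventually (ge_mem_nhds hk))).exists
    exact ⟨φ m, hφ m, hm1, hm2⟩
  choose φ hφ hφ1 hφ2 using hex
  refine hasH10Gradient_of_tendsto hv hV hφ ?_ ?_
  · have := ENNReal.tendsto_inv_nat_nhds_zero.add h
    rw [add_zero] at this
    refine tendsto_of_tendsto_of_tendsto_of_le_of_le tendsto_const_nhds this (fun _ => zero_le)
      fun k => ?_
    refine le_trans (le_of_eq ?_) ((eLpNorm_add_le
      (((hφ k).memLp 2 (volume.restrict Ω)).sub (hw k).hasH1Gradient.memLp).aestronglyMeasurable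
      ((hw k).hasH1Gradient.memLp.aestronglyMeasurable.sub hv) (by norm_num)).trans
        (add_le_add_left (hφ1 k) _))
    congr 1
    ext x
    simp
  · have := ENNReal.tendsto_inv_nat_nhds_zero.add h'
    rw [add_zero] at this
    refine tendsto_of_tendsto_of_tendsto_of_le_of_le tendsto_const_nhds this (fun _ => zero_le)
      fun k => ?_
    refine le_trans (le_of_eq ?_) ((eLpNorm_add_le
      (((hφ k).memLp_gradient 2 (volume.restrict Ω)).sub
        (hw k).hasH1Gradient.memLp_grad).aestronglyMeasurable
      ((hw k).hasH1Gradient.memLp_grad.aestronglyMeasurable.sub hV) (by norm_num)).trans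
        (add_le_add_left (hφ2 k) _))
    congr 1
    ext x
    simp

/-- Chain and product rule: if `u ∈ H¹(Ω)`, `Φ` is smooth with bounded derivative and `ζ` is a test
function, then `ζ Φ(u) ∈ H¹₀(Ω)`. -/
theorem HasH1Gradient.hasH10Gradient_mul_comp {n : ℕ} {Ω : Set (EuclideanSpace ℝ (Fin n))}
    {u : EuclideanSpace ℝ (Fin n) → ℝ} {G : EuclideanSpace ℝ (Fin n) → EuclideanSpace ℝ (Fin n)}
    (h : HasH1Gradient Ω u G) (hΩ : IsOpen Ω) (hu : StronglyMeasurable u)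
    (hG : StronglyMeasurable G) {ζ : EuclideanSpace ℝ (Fin n) → ℝ} (hζ : IsTestFunction Ω ζ)
    {Φ : ℝ → ℝ} (hΦ : ContDiff ℝ ∞ Φ) {c : ℝ} (hc : ∀ t, |deriv Φ t| ≤ c) :
    HasH10Gradient Ω (fun x => ζ x * Φ (u x))
      (fun x => ζ x • deriv Φ (u x) • G x + Φ (u x) • gradient ζ x) := by
  have hc0 : 0 ≤ c := (abs_nonneg _).trans (hc 0)
  have hΦ' : Continuous (deriv Φ) := hΦ.continuous_deriv (by simp)
  have hlip : ∀ s t, |Φ s - Φ t| ≤ c * |s - t| := fun s t =>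
    Convex.norm_image_sub_le_of_norm_deriv_le (fun x _ => hΦ.differentiable (by simp) x)
      (fun x _ => hc x) convex_univ (Set.mem_univ t) (Set.mem_univ s)
  set K := tsupport ζ
  obtain ⟨ψ₀, hψ₀, hψ₀1, hψ₀2⟩ := h.exists_contDiff_approx hΩ hζ.2.1 hζ.2.2 hu hG
  -- Along a subsequence the smooth approximations converge almost everywhere as well.
  obtain ⟨ns, hns, hae⟩ := (tendstoInMeasure_of_tendsto_eLpNorm two_ne_zero
    (fun k => (hψ₀ k).continuous.aestronglyMeasurable) hu.aestronglyMeasurable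
    hψ₀1).exists_seq_tendsto_ae
  set ψ := fun k => ψ₀ (ns k)
  have hψ : ∀ k, ContDiff ℝ ∞ (ψ k) := fun k => hψ₀ _
  have hψ1 := hψ₀1.comp hns.tendsto_atTop
  have hψ2 := hψ₀2.comp hns.tendsto_atTop
  obtain ⟨a, ha⟩ := hζ.2.1.exists_bound_of_continuous hζ.continuous
  obtain ⟨b, hb⟩ := (hasCompactSupport_gradient hζ.2.1).exists_bound_of_continuous
    hζ.continuous_gradient
  have ha0 : 0 ≤ a := (norm_nonneg _).trans (ha 0)
  have hζ0 : ∀ x ∉ K, ζ x = 0 := fun x hx => image_eq_zero_of_notMem_tsupport hx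
  have hζ0' : ∀ x ∉ K, gradient ζ x = 0 := fun x hx => gradient_eq_zero_of_notMem_tsupport hx
  have hGK : MemLp G 2 (volume.restrict K) := h.memLp_grad.mono_measure
    (Measure.restrict_mono hζ.2.2 le_rfl)
  have toK : ∀ {F : Type} [NormedAddCommGroup F] (f : EuclideanSpace ℝ (Fin n) → F),
      (∀ x ∉ K, f x = 0) → eLpNorm f 2 (volume.restrict Ω) = eLpNorm f 2 (volume.restrict K) := by
    intro F _ f hf
    have hs : Function.support f ⊆ K := fun x hx => by
      by_contra hxK
      exact hx (hf x hxK)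
    rw [eLpNorm_restrict_eq_of_support_subset hs,
      eLpNorm_restrict_eq_of_support_subset (hs.trans hζ.2.2)]
  have hΦu : StronglyMeasurable (fun x => Φ (u x)) := hΦ.continuous.comp_stronglyMeasurable hu
  have hΦ'u : StronglyMeasurable (fun x => deriv Φ (u x)) := hΦ'.comp_stronglyMeasurable hu
  have hgrad : ∀ k x, gradient (fun x => ζ x * Φ (ψ k x)) x
      = ζ x • deriv Φ (ψ k x) • gradient (ψ k) x + Φ (ψ k x) • gradient ζ x := fun k x =>
    ((hζ.1.hasGradientAt x).mul ((hΦ.differentiable (by simp) _).hasDerivAt.comp_hasGradientAt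
      ((hψ k).hasGradientAt x))).gradient
  refine hasH10Gradient_of_tendsto (φ := fun k x => ζ x * Φ (ψ k x))
    (hζ.continuous.stronglyMeasurable.mul hΦu).aestronglyMeasurable
    ((hζ.continuous.stronglyMeasurable.smul (hΦ'u.smul hG)).add
      (hΦu.smul hζ.continuous_gradient.stronglyMeasurable)).aestronglyMeasurable
    (fun k => ⟨hζ.1.mul (hΦ.comp (hψ k)), hζ.2.1.mul_right,
      (tsupport_mul_subset_left).trans hζ.2.2⟩) ?_ ?_
  · have h1 : Tendsto (fun k => ENNReal.ofReal (a * c) *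
        eLpNorm (fun x => ψ k x - u x) 2 (volume.restrict K)) atTop (𝓝 0) := by
      simpa using ENNReal.Tendsto.const_mul hψ1 (Or.inr ENNReal.ofReal_ne_top)
    refine tendsto_of_tendsto_of_tendsto_of_le_of_le tendsto_const_nhds h1 (fun _ => zero_le)
      fun k => ?_
    dsimp only
    rw [toK _ fun x hx => by simp [hζ0 x hx]]
    refine eLpNorm_le_mul_eLpNorm_of_ae_le_mul (Eventually.of_forall fun x => ?_) 2
    rw [← mul_sub, norm_mul, mul_assoc]
    exact mul_le_mul (ha x) (hlip _ _) (norm_nonneg _) ha0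
  · -- Split the error of the gradients: `T1` and `T3` are controlled by the `H¹` convergence of `ψ`,
    -- `T2` by dominated convergence, since `deriv Φ (ψ k x)` is only known to converge pointwise.
    set T1 := fun k x => ζ x • deriv Φ (ψ k x) • (gradient (ψ k) x - G x) with hT1
    set T2 := fun k x => ζ x • (deriv Φ (ψ k x) - deriv Φ (u x)) • G x with hT2
    set T3 := fun k x => (Φ (ψ k x) - Φ (u x)) • gradient ζ x with hT3
    have mΦ : ∀ k, StronglyMeasurable (fun x => Φ (ψ k x)) := fun k =>
      (hΦ.continuous.comp (hψ k).continuous).stronglyMeasurable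
    have mΦ' : ∀ k, StronglyMeasurable (fun x => deriv Φ (ψ k x)) := fun k =>
      (hΦ'.comp (hψ k).continuous).stronglyMeasurable
    have m1 : ∀ k, StronglyMeasurable (T1 k) := fun k =>
      hζ.continuous.stronglyMeasurable.smul
        ((mΦ' k).smul ((hψ k).continuous_gradient.stronglyMeasurable.sub hG))
    have m2 : ∀ k, StronglyMeasurable (T2 k) := fun k =>
      hζ.continuous.stronglyMeasurable.smul (((mΦ' k).sub hΦ'u).smul hG)
    have m3 : ∀ k, StronglyMeasurable (T3 k) := fun k =>
      ((mΦ k).sub hΦu).smul hζ.continuous_gradient.stronglyMeasurable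
    have l1 : Tendsto (fun k => eLpNorm (T1 k) 2 (volume.restrict K)) atTop (𝓝 0) := by
      have h1 : Tendsto (fun k => ENNReal.ofReal (a * c) *
          eLpNorm (fun x => gradient (ψ k) x - G x) 2 (volume.restrict K)) atTop (𝓝 0) := by
        simpa using ENNReal.Tendsto.const_mul hψ2 (Or.inr ENNReal.ofReal_ne_top)
      refine tendsto_of_tendsto_of_tendsto_of_le_of_le tendsto_const_nhds h1 (fun _ => zero_le)
        fun k => eLpNorm_le_mul_eLpNorm_of_ae_le_mul (Eventually.of_forall fun x => ?_) 2
      rw [hT1, norm_smul, norm_smul, ← mul_assoc]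
      gcongr
      exacts [ha x, hc _]
    have l2 : Tendsto (fun k => eLpNorm (T2 k) 2 (volume.restrict K)) atTop (𝓝 0) := by
      refine tendsto_eLpNorm_two_of_dominated (b := fun x => a * (2 * c) * ‖G x‖)
        (fun k => (m2 k).aestronglyMeasurable) (hGK.norm.const_mul _)
        (fun k => Eventually.of_forall fun x => ?_) ?_
      · rw [hT2, norm_smul, norm_smul, ← mul_assoc]
        gcongr
        · exact ha x
        · exact (norm_sub_le _ _).trans ((add_le_add (hc _) (hc _)).trans_eq (two_mul c).symm)
      · filter_upwards [hae] with x hx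
        have h1 : Tendsto (fun k => deriv Φ (ψ k x) - deriv Φ (u x)) atTop (𝓝 0) := by
          have := ((hΦ'.tendsto _).comp hx).sub_const (deriv Φ (u x))
          rwa [sub_self] at this
        simpa using (h1.smul_const (G x)).const_smul (ζ x)
    have l3 : Tendsto (fun k => eLpNorm (T3 k) 2 (volume.restrict K)) atTop (𝓝 0) := by
      have h1 : Tendsto (fun k => ENNReal.ofReal (c * b) *
          eLpNorm (fun x => ψ k x - u x) 2 (volume.restrict K)) atTop (𝓝 0) := by
        simpa using ENNReal.Tendsto.const_mul hψ1 (Or.inr ENNReal.ofReal_ne_top)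
      refine tendsto_of_tendsto_of_tendsto_of_le_of_le tendsto_const_nhds h1 (fun _ => zero_le)
        fun k => eLpNorm_le_mul_eLpNorm_of_ae_le_mul (Eventually.of_forall fun x => ?_) 2
      rw [hT3, norm_smul, mul_right_comm]
      exact mul_le_mul (hlip _ _) (hb x) (norm_nonneg _) (by positivity)
    have hsum := (l1.add l2).add l3
    simp only [add_zero] at hsum
    refine tendsto_of_tendsto_of_tendsto_of_le_of_le tendsto_const_nhds hsum (fun _ => zero_le)
      fun k => ?_
    dsimp only
    rw [toK _ fun x hx => by simp [hgrad, hζ0 x hx, hζ0' x hx]]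
    refine le_trans (le_of_eq ?_) ((eLpNorm_add_le
      ((m1 k).add (m2 k)).aestronglyMeasurable (m3 k).aestronglyMeasurable (by norm_num)).trans
      (add_le_add_left (eLpNorm_add_le (m1 k).aestronglyMeasurable (m2 k).aestronglyMeasurable
        (by norm_num)) _))
    congr 1
    ext1 x
    rw [hgrad]
    simp only [hT1, hT2, hT3, Pi.add_apply]
    module

/-! ### Truncations -/

theorem deriv_smoothTransition_of_neg {t : ℝ} (ht : t < 0) : deriv Real.smoothTransition t = 0 := by
  have : Real.smoothTransition =ᶠ[𝓝 t] fun _ => 0 := by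
    filter_upwards [gt_mem_nhds ht] with s hs
    exact Real.smoothTransition.zero_of_nonpos hs.le
  rw [this.deriv_eq, deriv_const]

theorem deriv_smoothTransition_of_one_lt {t : ℝ} (ht : 1 < t) :
    deriv Real.smoothTransition t = 0 := by
  have : Real.smoothTransition =ᶠ[𝓝 t] fun _ => 1 := by
    filter_upwards [lt_mem_nhds ht] with s hs
    exact Real.smoothTransition.one_of_one_le hs.le
  rw [this.deriv_eq, deriv_const]

theorem exists_abs_deriv_smoothTransition_le :
    ∃ c : ℝ, 0 < c ∧ ∀ t, |deriv Real.smoothTransition t| ≤ c := by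
  obtain ⟨c, hc⟩ := (isCompact_Icc (a := (0 : ℝ)) (b := 1)).exists_bound_of_continuousOn
    ((Real.smoothTransition.contDiff (n := 1)).continuous_deriv le_rfl).continuousOn
  refine ⟨max c 1, by positivity, fun t => ?_⟩
  rcases lt_or_ge t 0 with h0 | h0
  · rw [deriv_smoothTransition_of_neg h0, abs_zero]
    positivity
  rcases lt_or_ge 1 t with h1 | h1
  · rw [deriv_smoothTransition_of_one_lt h1, abs_zero]
    positivity
  · exact (hc t ⟨h0, h1⟩).trans (le_max_left _ _)

/-- A smooth approximation of the positive part: it vanishes for `t ≤ 0` and equals `t` for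
`t ≥ 1`. -/
noncomputable def smoothPosPart (t : ℝ) : ℝ := t * Real.smoothTransition t

theorem contDiff_smoothPosPart : ContDiff ℝ ∞ smoothPosPart :=
  contDiff_id.mul (Real.smoothTransition.contDiff (n := ⊤))

theorem hasDerivAt_smoothPosPart (t : ℝ) : HasDerivAt smoothPosPart
    (Real.smoothTransition t + t * deriv Real.smoothTransition t) t := by
  have h := ((Real.smoothTransition.contDiff (n := 1)).differentiable (by simp) t).hasDerivAt
  have h2 := (hasDerivAt_id t).mul h
  simp only [id_eq, one_mul] at h2
  exact h2

theorem deriv_smoothPosPart_of_nonpos {t : ℝ} (ht : t ≤ 0) : deriv smoothPosPart t = 0 := by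
  rw [(hasDerivAt_smoothPosPart t).deriv, Real.smoothTransition.zero_of_nonpos ht]
  rcases ht.lt_or_eq with h | h
  · simp [deriv_smoothTransition_of_neg h]
  · simp [h]

theorem deriv_smoothPosPart_of_one_lt {t : ℝ} (ht : 1 < t) : deriv smoothPosPart t = 1 := by
  rw [(hasDerivAt_smoothPosPart t).deriv, Real.smoothTransition.one_of_one_le ht.le,
    deriv_smoothTransition_of_one_lt ht]
  simp

theorem exists_abs_deriv_smoothPosPart_le : ∃ c : ℝ, ∀ t, |deriv smoothPosPart t| ≤ c := by
  obtain ⟨c, hc0, hc⟩ := exists_abs_deriv_smoothTransition_le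
  refine ⟨1 + c, fun t => ?_⟩
  rcases le_or_gt t 0 with h0 | h0
  · rw [deriv_smoothPosPart_of_nonpos h0, abs_zero]
    positivity
  rcases lt_or_ge 1 t with h1 | h1
  · rw [deriv_smoothPosPart_of_one_lt h1, abs_one]
    linarith
  · rw [(hasDerivAt_smoothPosPart t).deriv]
    refine (abs_add_le _ _).trans (add_le_add ?_ ?_)
    · rw [abs_of_nonneg (Real.smoothTransition.nonneg t)]
      exact Real.smoothTransition.le_one t
    · rw [abs_mul, abs_of_pos h0]
      exact (mul_le_of_le_one_left (abs_nonneg _) h1).trans (hc t)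

theorem abs_smoothPosPart_sub_le (t : ℝ) : |smoothPosPart t - max t 0| ≤ 1 := by
  unfold smoothPosPart
  have h1 := Real.smoothTransition.nonneg t
  have h2 := Real.smoothTransition.le_one t
  rcases le_or_gt t 0 with h0 | h0
  · simp [Real.smoothTransition.zero_of_nonpos h0, max_eq_right h0]
  rcases lt_or_ge 1 t with h3 | h3
  · simp [Real.smoothTransition.one_of_one_le h3.le, max_eq_left h0.le]
  · rw [max_eq_left h0.le, abs_le]
    constructor <;> nlinarith

/-- The truncation `(u - k)⁺` of an `H¹(Ω)` function, localised by a test function `ζ`, belongs to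
`H¹₀(Ω)`. -/
theorem HasH1Gradient.hasH10Gradient_mul_truncation {n : ℕ} {Ω : Set (EuclideanSpace ℝ (Fin n))}
    {u : EuclideanSpace ℝ (Fin n) → ℝ} {G : EuclideanSpace ℝ (Fin n) → EuclideanSpace ℝ (Fin n)}
    (h : HasH1Gradient Ω u G) (hΩ : IsOpen Ω) (hu : StronglyMeasurable u)
    (hG : StronglyMeasurable G) {ζ : EuclideanSpace ℝ (Fin n) → ℝ} (hζ : IsTestFunction Ω ζ)
    (k : ℝ) :
    HasH10Gradient Ω (fun x => ζ x * max (u x - k) 0)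
      (fun x => ζ x • {x | k < u x}.indicator G x + max (u x - k) 0 • gradient ζ x) := by
  obtain ⟨c, hc⟩ := exists_abs_deriv_smoothPosPart_le
  have hc0 : 0 ≤ c := (abs_nonneg _).trans (hc 0)
  let ε : ℕ → ℝ := fun j => ((j : ℝ) + 1)⁻¹
  have hε : ∀ j, 0 < ε j := fun j => by positivity
  have hεlim : Tendsto ε atTop (𝓝 0) := by
    simpa [ε] using tendsto_one_div_add_atTop_nhds_zero_nat (𝕜 := ℝ)
  let Φ : ℕ → ℝ → ℝ := fun j t => ε j * smoothPosPart ((t - k) / ε j)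
  have hΦ : ∀ j, ContDiff ℝ ∞ (Φ j) := fun j =>
    contDiff_const.mul (contDiff_smoothPosPart.comp ((contDiff_id.sub contDiff_const).div_const _))
  have hΦ' : ∀ j t, deriv (Φ j) t = deriv smoothPosPart ((t - k) / ε j) := by
    intro j t
    have h1 : HasDerivAt (fun t => (t - k) / ε j) (1 / ε j) t :=
      ((hasDerivAt_id t).sub_const k).div_const _
    have h2 := ((contDiff_smoothPosPart.differentiable (by simp)
      ((t - k) / ε j)).hasDerivAt.comp t h1).const_mul (ε j)
    refine h2.deriv.trans ?_
    field_simp [(hε j).ne']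
  have hΦlim : ∀ j t, |Φ j t - max (t - k) 0| ≤ ε j := by
    intro j t
    have h1 : max (t - k) 0 = ε j * max ((t - k) / ε j) 0 := by
      rw [mul_max_of_nonneg _ _ (hε j).le, mul_div_cancel₀ _ (hε j).ne', mul_zero]
    rw [h1, ← mul_sub, abs_mul, abs_of_pos (hε j)]
    exact mul_le_of_le_one_right (hε j).le (abs_smoothPosPart_sub_le _)
  have hS : MeasurableSet {x | k < u x} := measurableSet_lt measurable_const hu.measurable
  have hmax : StronglyMeasurable (fun x => max (u x - k) 0) :=
    (hu.sub stronglyMeasurable_const).sup stronglyMeasurable_const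
  have hζm := hζ.continuous.stronglyMeasurable
  have hζm' := hζ.continuous_gradient.stronglyMeasurable
  obtain ⟨a, ha⟩ := hζ.2.1.exists_bound_of_continuous hζ.continuous
  have ha0 : 0 ≤ a := (norm_nonneg _).trans (ha 0)
  refine HasH10Gradient.of_tendsto (hζm.mul hmax).aestronglyMeasurable
    ((hζm.smul (hG.indicator hS)).add (hmax.smul hζm')).aestronglyMeasurable
    (fun j => h.hasH10Gradient_mul_comp hΩ hu hG hζ (hΦ j) (c := c)
      (fun t => by rw [hΦ']; exact hc _)) ?_ ?_
  · have h1 : Tendsto (fun j => ENNReal.ofReal (ε j) * eLpNorm ζ 2 (volume.restrict Ω))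
        atTop (𝓝 0) := by
      have := ENNReal.Tendsto.mul_const (ENNReal.tendsto_ofReal hεlim)
        (Or.inr (hζ.memLp 2 (volume.restrict Ω)).eLpNorm_ne_top)
      simpa using this
    refine tendsto_of_tendsto_of_tendsto_of_le_of_le tendsto_const_nhds h1 (fun _ => zero_le)
      fun j => eLpNorm_le_mul_eLpNorm_of_ae_le_mul (Eventually.of_forall fun x => ?_) 2
    rw [← mul_sub, norm_mul, mul_comm]
    exact mul_le_mul_of_nonneg_right (hΦlim j _) (norm_nonneg _)
  · set T1 := fun j x => ζ x • (deriv (Φ j) (u x) • G x - {x | k < u x}.indicator G x) with hT1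
    set T2 := fun j x => (Φ j (u x) - max (u x - k) 0) • gradient ζ x with hT2
    have m1 : ∀ j, StronglyMeasurable (T1 j) := fun j => hζm.smul
      (((((hΦ j).continuous_deriv (by simp)).comp_stronglyMeasurable hu).smul hG).sub
        (hG.indicator hS))
    have m2 : ∀ j, StronglyMeasurable (T2 j) := fun j =>
      (((hΦ j).continuous.comp_stronglyMeasurable hu).sub hmax).smul hζm'
    have l1 : Tendsto (fun j => eLpNorm (T1 j) 2 (volume.restrict Ω)) atTop (𝓝 0) := by
      refine tendsto_eLpNorm_two_of_dominated (b := fun x => a * (c + 1) * ‖G x‖)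
        (fun j => (m1 j).aestronglyMeasurable) (h.memLp_grad.norm.const_mul _)
        (fun j => Eventually.of_forall fun x => ?_) (Eventually.of_forall fun x => ?_)
      · rw [hT1, norm_smul, mul_assoc]
        refine mul_le_mul (ha x) ((norm_sub_le _ _).trans ?_) (norm_nonneg _) ha0
        rw [norm_smul, add_mul, one_mul]
        refine add_le_add ?_ (norm_indicator_le_norm_self _ _)
        gcongr
        rw [hΦ']
        exact hc _
      · -- The approximating derivative vanishes where `u = k`, so no information on `G` is needed
        -- on that set.
        refine tendsto_const_nhds.congr' ?_
        rcases le_or_gt (u x) k with hx | hx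
        · refine Eventually.of_forall fun j => ?_
          have : deriv (Φ j) (u x) = 0 := by
            rw [hΦ']
            exact deriv_smoothPosPart_of_nonpos
              (div_nonpos_of_nonpos_of_nonneg (by linarith) (hε j).le)
          simp [hT1, this, hx.not_gt]
        · filter_upwards [hεlim.eventually (gt_mem_nhds (sub_pos.2 hx))] with j hj
          have : deriv (Φ j) (u x) = 1 := by
            rw [hΦ']
            exact deriv_smoothPosPart_of_one_lt ((one_lt_div (hε j)).2 hj)
          simp [hT1, this, hx]
    have l2 : Tendsto (fun j => eLpNorm (T2 j) 2 (volume.restrict Ω)) atTop (𝓝 0) := by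
      have h1 : Tendsto (fun j => ENNReal.ofReal (ε j) *
          eLpNorm (gradient ζ) 2 (volume.restrict Ω)) atTop (𝓝 0) := by
        have := ENNReal.Tendsto.mul_const (ENNReal.tendsto_ofReal hεlim)
          (Or.inr (hζ.memLp_gradient 2 (volume.restrict Ω)).eLpNorm_ne_top)
        simpa using this
      refine tendsto_of_tendsto_of_tendsto_of_le_of_le tendsto_const_nhds h1 (fun _ => zero_le)
        fun j => eLpNorm_le_mul_eLpNorm_of_ae_le_mul (Eventually.of_forall fun x => ?_) 2
      rw [hT2, norm_smul]
      exact mul_le_mul_of_nonneg_right (hΦlim j _) (norm_nonneg _)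
    have hsum := l1.add l2
    rw [add_zero] at hsum
    refine tendsto_of_tendsto_of_tendsto_of_le_of_le tendsto_const_nhds hsum (fun _ => zero_le)
      fun j => le_trans (le_of_eq ?_) (eLpNorm_add_le (m1 j).aestronglyMeasurable
        (m2 j).aestronglyMeasurable (by norm_num))
    congr 1
    ext1 x
    simp only [hT1, hT2, Pi.add_apply]
    module

/-! ### The Sobolev inequality on `H¹₀` and cutoff functions -/

/-- The Sobolev inequality on `H¹₀` of a bounded set, for a subcritical exponent `s`. The auxiliary
exponent `t < 2 ≤ n` makes the inequality available in dimension two as well. -/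
theorem HasH10Gradient.exists_eLpNorm_le {n : ℕ} (hn : 2 ≤ n)
    {Ω : Set (EuclideanSpace ℝ (Fin n))} (hΩ : Bornology.IsBounded Ω) {s t : NNReal}
    (ht1 : 1 ≤ t) (ht2 : t < 2) (hst : (s : ℝ)⁻¹ = (t : ℝ)⁻¹ - (n : ℝ)⁻¹) :
    ∃ C : NNReal, ∀ v V, HasH10Gradient Ω v V →
      eLpNorm v s (volume.restrict Ω) ≤ C * eLpNorm V 2 (volume.restrict Ω) := by
  set C₁ : NNReal := SNormLESNormFDerivOfEqConst ℝ
    (volume : Measure (EuclideanSpace ℝ (Fin n))) t with hC₁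
  set m : ℝ≥0∞ := volume Ω ^ (1 / (t : ℝ≥0∞).toReal - 1 / (2 : ℝ≥0∞).toReal) with hm
  have hexp : 0 ≤ 1 / (t : ℝ≥0∞).toReal - 1 / (2 : ℝ≥0∞).toReal := by
    have h1 : (1 : ℝ) ≤ t := by exact_mod_cast ht1
    have h2 : (t : ℝ) ≤ 2 := by exact_mod_cast ht2.le
    simp only [ENNReal.coe_toReal, ENNReal.toReal_ofNat, sub_nonneg]
    exact one_div_le_one_div_of_le (by positivity) h2
  have hmtop : m ≠ ⊤ := ENNReal.rpow_ne_top_of_nonneg hexp hΩ.measure_lt_top.ne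
  refine ⟨C₁ * m.toNNReal, fun v V h => ?_⟩
  obtain ⟨φ, hφ, h1, h2⟩ := h.exists_approx
  have hsmooth : ∀ k, eLpNorm (φ k) s (volume.restrict Ω)
      ≤ (C₁ * m.toNNReal : NNReal) * eLpNorm (gradient (φ k)) 2 (volume.restrict Ω) := by
    intro k
    have hsupp : Function.support (gradient (φ k)) ⊆ Ω := fun x hx => by
      by_contra hxΩ
      exact hx (gradient_eq_zero_of_notMem_tsupport fun h' => hxΩ ((hφ k).2.2 h'))
    calc eLpNorm (φ k) s (volume.restrict Ω) ≤ eLpNorm (φ k) s volume :=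
          eLpNorm_mono_measure _ Measure.restrict_le_self
      _ ≤ C₁ * eLpNorm (fderiv ℝ (φ k)) t volume := by
          refine eLpNorm_le_eLpNorm_fderiv_of_eq volume ((hφ k).1.of_le (by simp)) (hφ k).2.1 ht1
            ?_ ?_
          · rw [finrank_euclideanSpace_fin]; omega
          · rw [finrank_euclideanSpace_fin]; exact hst
      _ = C₁ * eLpNorm (gradient (φ k)) t (volume.restrict Ω) := by
          rw [eLpNorm_restrict_eq_of_support_subset hsupp]
          congr 1
          refine eLpNorm_congr_norm_ae (Eventually.of_forall fun x => ?_)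
          rw [← toDual_gradient, LinearIsometryEquiv.norm_map]
      _ ≤ C₁ * (eLpNorm (gradient (φ k)) 2 (volume.restrict Ω) * m) := by
          gcongr
          have := eLpNorm_le_eLpNorm_mul_rpow_measure_univ (μ := volume.restrict Ω)
            (p := t) (q := 2) (by exact_mod_cast ht2.le)
            (hφ k).continuous_gradient.aestronglyMeasurable
          rwa [Measure.restrict_apply_univ] at this
      _ = _ := by
          rw [ENNReal.coe_mul, ENNReal.coe_toNNReal hmtop]
          ring
  have hv := h.hasH1Gradient.memLp
  have hV := h.hasH1Gradient.memLp_grad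
  obtain ⟨ns, hns, hae⟩ := (tendstoInMeasure_of_tendsto_eLpNorm two_ne_zero
    (fun k => (hφ k).continuous.aestronglyMeasurable) hv.aestronglyMeasurable
    h1).exists_seq_tendsto_ae
  have hlim : Tendsto (fun k => ((C₁ * m.toNNReal : NNReal) : ℝ≥0∞) *
      (eLpNorm (fun x => gradient (φ (ns k)) x - V x) 2 (volume.restrict Ω)
        + eLpNorm V 2 (volume.restrict Ω))) atTop
      (𝓝 ((C₁ * m.toNNReal : NNReal) * eLpNorm V 2 (volume.restrict Ω))) := by
    have := (h2.comp hns.tendsto_atTop).add_const (eLpNorm V 2 (volume.restrict Ω))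
    rw [zero_add] at this
    exact ENNReal.Tendsto.const_mul this (Or.inr ENNReal.coe_ne_top)
  refine (Lp.eLpNorm_lim_le_liminf_eLpNorm
    (fun k => (hφ (ns k)).continuous.aestronglyMeasurable) v hae).trans ?_
  rw [← hlim.liminf_eq]
  refine liminf_le_liminf (Eventually.of_forall fun k => (hsmooth (ns k)).trans ?_)
  gcongr
  refine le_trans (le_of_eq ?_) (eLpNorm_add_le
    ((hφ (ns k)).continuous_gradient.aestronglyMeasurable.sub hV.aestronglyMeasurable)
    hV.aestronglyMeasurable (by norm_num))
  congr 1
  ext x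
  simp

/-- Cutoff functions between concentric balls whose gradient is controlled by the distance of the
spheres. The constant depends only on the profile `Real.smoothTransition`. -/
theorem exists_cutoff : ∃ c : ℝ, 0 < c ∧ ∀ (n : ℕ) (ρ σ : ℝ), 0 < ρ → ρ < σ →
    ∃ η : EuclideanSpace ℝ (Fin n) → ℝ, ContDiff ℝ ∞ η ∧ (∀ x, 0 ≤ η x) ∧ (∀ x, η x ≤ 1) ∧
      (∀ x ∈ Metric.ball 0 ρ, η x = 1) ∧ tsupport η ⊆ Metric.closedBall 0 σ ∧
      ∀ x, ‖gradient η x‖ ≤ c / (σ - ρ) := by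
  obtain ⟨c, hc0, hc⟩ := exists_abs_deriv_smoothTransition_le
  refine ⟨2 * c, by positivity, fun n ρ σ hρ hρσ => ?_⟩
  have hd : 0 < σ ^ 2 - ρ ^ 2 := by nlinarith
  set e : EuclideanSpace ℝ (Fin n) → ℝ := fun x => (σ ^ 2 - ‖x‖ ^ 2) / (σ ^ 2 - ρ ^ 2) with he
  have hes : ContDiff ℝ ∞ e := (contDiff_const.sub (contDiff_norm_sq ℝ)).div_const _
  have heg : ∀ x, HasGradientAt e ((-2 / (σ ^ 2 - ρ ^ 2)) • x) x := by
    intro x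
    rw [hasGradientAt_iff_hasFDerivAt]
    have h1 := ((hasStrictFDerivAt_norm_sq x).hasFDerivAt.const_sub (σ ^ 2)).mul_const
      (σ ^ 2 - ρ ^ 2)⁻¹
    convert! h1 using 1
    ext y
    simp
    ring
  have hsupp : ∀ x, σ < ‖x‖ → e x ≤ 0 := fun x hx =>
    div_nonpos_of_nonpos_of_nonneg (by nlinarith) hd.le
  refine ⟨fun x => Real.smoothTransition (e x), (Real.smoothTransition.contDiff (n := ⊤)).comp hes,
    fun x => Real.smoothTransition.nonneg _, fun x => Real.smoothTransition.le_one _,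
    fun x hx => ?_, closure_minimal (fun x hx => ?_) Metric.isClosed_closedBall, fun x => ?_⟩
  · refine Real.smoothTransition.one_of_one_le ((one_le_div hd).2 ?_)
    have := mem_ball_zero_iff.1 hx
    nlinarith [norm_nonneg x]
  · rw [mem_closedBall_zero_iff]
    by_contra! hxσ
    exact hx (Real.smoothTransition.zero_of_nonpos (hsupp x hxσ))
  · have hT := ((Real.smoothTransition.contDiff (n := 1)).differentiable (by simp) (e x)).hasDerivAt
    rw [(hT.comp_hasGradientAt (heg x)).gradient]
    have hd' : 0 < σ - ρ := sub_pos.2 hρσ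
    rcases le_or_gt ‖x‖ σ with hx | hx
    · rw [norm_smul, norm_smul, Real.norm_eq_abs, Real.norm_eq_abs, abs_div, abs_neg, abs_two,
        abs_of_pos hd]
      calc |deriv Real.smoothTransition (e x)| * (2 / (σ ^ 2 - ρ ^ 2) * ‖x‖)
          ≤ c * (2 / (σ ^ 2 - ρ ^ 2) * σ) := by
            gcongr
            exact hc _
        _ ≤ 2 * c / (σ - ρ) := by
            rw [show σ ^ 2 - ρ ^ 2 = (σ - ρ) * (σ + ρ) by ring, ← sub_nonneg]
            have hσρ : 0 < σ + ρ := by linarith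
            have : 2 * c / (σ - ρ) - c * (2 / ((σ - ρ) * (σ + ρ)) * σ)
                = 2 * c * ρ / ((σ - ρ) * (σ + ρ)) := by
              field_simp
              ring
            rw [this]
            positivity
    · have : deriv Real.smoothTransition (e x) = 0 := by
        refine deriv_smoothTransition_of_neg (div_neg_of_neg_of_pos ?_ hd)
        nlinarith
      rw [this, zero_smul, norm_zero]
      positivity

/-! ### Hölder's inequality on level sets -/

theorem toReal_eLpNorm_two_sq {α F : Type*} [MeasurableSpace α] [NormedAddCommGroup F]
    {μ : Measure α} {f : α → F} (hf : AEStronglyMeasurable f μ) :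
    (eLpNorm f 2 μ).toReal ^ 2 = ∫ x, ‖f x‖ ^ 2 ∂μ := by
  rw [← ENNReal.toReal_pow, eLpNorm_two_sq, integral_eq_lintegral_of_nonneg_ae
    (f := fun x => ‖f x‖ ^ 2) (Eventually.of_forall fun x => by positivity) (hf.norm.pow 2)]
  congr 1
  refine lintegral_congr fun x => ?_
  rw [ENNReal.ofReal_pow (norm_nonneg _), ofReal_norm]

/-- Hölder's inequality with three factors, the third one being the indicator of a set that carries
the integrand. -/
theorem abs_integral_le_of_support_subset {α : Type*} [MeasurableSpace α] {μ : Measure α}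
    {S : Set α} (hS : μ S ≠ ⊤) {p s : ℝ} (hp : 0 < p) (hs : 0 < s)
    (hps : 1 / p + 1 / s ≤ 1) {f g h : α → ℝ} (hf : MemLp f (ENNReal.ofReal p) μ)
    (hg : MemLp g (ENNReal.ofReal s) μ) (hfg : ∀ x, |h x| ≤ |f x| * |g x|)
    (hh : ∀ x ∉ S, h x = 0) :
    |∫ x, h x ∂μ| ≤ (eLpNorm f (ENNReal.ofReal p) μ).toReal *
      (eLpNorm g (ENNReal.ofReal s) μ).toReal * μ.real S ^ (1 - 1 / p - 1 / s) := by
  set τ : ℝ := (1 / p + 1 / s)⁻¹ with hτ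
  have hsum : 0 < 1 / p + 1 / s := by positivity
  have hτ0 : 0 < τ := by positivity
  have hτ1 : 1 ≤ τ := (one_le_inv₀ hsum).2 hps
  have hT : ENNReal.HolderTriple (ENNReal.ofReal p) (ENNReal.ofReal s) (ENNReal.ofReal τ) := by
    constructor
    rw [← ENNReal.ofReal_inv_of_pos hp, ← ENNReal.ofReal_inv_of_pos hs,
      ← ENNReal.ofReal_inv_of_pos hτ0, ← ENNReal.ofReal_add (by positivity) (by positivity), hτ,
      inv_inv, one_div, one_div]
  have hfin : eLpNorm f (ENNReal.ofReal p) μ * eLpNorm g (ENNReal.ofReal s) μ *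
      μ S ^ (1 - 1 / p - 1 / s) ≠ ⊤ := by
    refine ENNReal.mul_ne_top (ENNReal.mul_ne_top hf.eLpNorm_ne_top hg.eLpNorm_ne_top) ?_
    exact ENNReal.rpow_ne_top_of_nonneg (by linarith) hS
  have hsupp : Function.support h ⊆ S := fun x hx => by
    by_contra hxS
    exact hx (hh x hxS)
  have hle : ‖∫ x, h x ∂μ‖ₑ ≤ eLpNorm f (ENNReal.ofReal p) μ * eLpNorm g (ENNReal.ofReal s) μ *
      μ S ^ (1 - 1 / p - 1 / s) :=
    calc ‖∫ x, h x ∂μ‖ₑ ≤ ∫⁻ x, ‖h x‖ₑ ∂μ := enorm_integral_le_lintegral_enorm _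
      _ = eLpNorm h 1 (μ.restrict S) := by
        rw [eLpNorm_restrict_eq_of_support_subset hsupp, eLpNorm_one_eq_lintegral_enorm]
      _ ≤ eLpNorm (f • g) 1 (μ.restrict S) := by
        refine eLpNorm_mono fun x => ?_
        rw [Pi.smul_apply', norm_smul]
        exact hfg x
      _ ≤ eLpNorm (f • g) (ENNReal.ofReal τ) (μ.restrict S) *
          μ.restrict S Set.univ ^ (1 / (1 : ℝ≥0∞).toReal - 1 / (ENNReal.ofReal τ).toReal) :=
        eLpNorm_le_eLpNorm_mul_rpow_measure_univ (by simpa using hτ1)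
          (hf.aestronglyMeasurable.smul hg.aestronglyMeasurable).restrict
      _ ≤ _ := by
        rw [Measure.restrict_apply_univ, ENNReal.toReal_ofReal hτ0.le, ENNReal.toReal_one,
          one_div_one, hτ, one_div (1 / p + 1 / s)⁻¹, inv_inv, ← sub_sub]
        gcongr
        exact (eLpNorm_mono_measure _ Measure.restrict_le_self).trans
          (eLpNorm_smul_le_mul_eLpNorm hg.aestronglyMeasurable hf.aestronglyMeasurable)
  have := ENNReal.toReal_mono hfin hle
  rwa [ENNReal.toReal_mul, ENNReal.toReal_mul, ← ENNReal.toReal_rpow, toReal_enorm] at this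

/-- Hölder's inequality for the `L²` norm of a function carried by a set. -/
theorem integral_norm_sq_le_of_support_subset {α F : Type*} [MeasurableSpace α]
    [NormedAddCommGroup F] {μ : Measure α} {S : Set α} (hS : μ S ≠ ⊤) {p : ℝ} (hp : 2 ≤ p)
    {g : α → F} {h : α → ℝ} (hg : MemLp g (ENNReal.ofReal p) μ) (hhm : AEStronglyMeasurable h μ)
    (hhg : ∀ x, |h x| ≤ ‖g x‖) (hh : ∀ x ∉ S, h x = 0) :
    ∫ x, h x ^ 2 ∂μ ≤ (eLpNorm g (ENNReal.ofReal p) μ).toReal ^ 2 * μ.real S ^ (1 - 2 / p) := by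
  have hp0 : 0 < p := by linarith
  have hexp : 0 ≤ 1 / 2 - 1 / p := sub_nonneg.2 (one_div_le_one_div_of_le two_pos hp)
  have hsupp : Function.support h ⊆ S := fun x hx => by
    by_contra hxS
    exact hx (hh x hxS)
  have hle : eLpNorm h 2 μ ≤ eLpNorm g (ENNReal.ofReal p) μ * μ S ^ (1 / 2 - 1 / p) :=
    calc eLpNorm h 2 μ = eLpNorm h 2 (μ.restrict S) :=
          (eLpNorm_restrict_eq_of_support_subset hsupp).symm
      _ ≤ eLpNorm g 2 (μ.restrict S) := eLpNorm_mono hhg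
      _ ≤ eLpNorm g (ENNReal.ofReal p) (μ.restrict S) *
          μ.restrict S Set.univ ^ (1 / (2 : ℝ≥0∞).toReal - 1 / (ENNReal.ofReal p).toReal) :=
        eLpNorm_le_eLpNorm_mul_rpow_measure_univ
          (by rw [← ENNReal.ofReal_ofNat]; exact ENNReal.ofReal_le_ofReal hp)
          hg.aestronglyMeasurable.restrict
      _ ≤ _ := by
        rw [Measure.restrict_apply_univ, ENNReal.toReal_ofReal hp0.le, ENNReal.toReal_ofNat]
        gcongr
        exact Measure.restrict_le_self
  have hle' := ENNReal.toReal_mono (ENNReal.mul_ne_top hg.eLpNorm_ne_top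
    (ENNReal.rpow_ne_top_of_nonneg hexp hS)) hle
  rw [ENNReal.toReal_mul, ← ENNReal.toReal_rpow] at hle'
  have h2 := pow_le_pow_left₀ ENNReal.toReal_nonneg hle' 2
  rw [toReal_eLpNorm_two_sq hhm, mul_pow, ← Real.rpow_mul_natCast ENNReal.toReal_nonneg] at h2
  simp only [Real.norm_eq_abs, sq_abs] at h2
  convert! h2 using 3
  push_cast
  ring

/-! ### The Caccioppoli inequality -/

theorem sum_abs_le_sqrt_mul_norm {n : ℕ} (z : EuclideanSpace ℝ (Fin n)) :
    ∑ i, |z i| ≤ Real.sqrt n * ‖z‖ := by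
  refine Real.le_sqrt_of_sq_le ?_ |>.trans_eq ?_ (b := Real.sqrt (n * ‖z‖ ^ 2))
  · have := sq_sum_le_card_mul_sum_sq (s := Finset.univ) (f := fun i => |z i|)
    rw [PiLp.norm_sq_eq_of_L2]
    simpa using this
  · rw [Real.sqrt_mul (by positivity), Real.sqrt_sq (norm_nonneg _)]

theorem abs_mulVec_dotProduct_le {n : ℕ} {M : Matrix (Fin n) (Fin n) ℝ} {L : ℝ} (hL : 0 ≤ L)
    (hM : ∀ i j, |M i j| ≤ L) (g z : EuclideanSpace ℝ (Fin n)) :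
    |(M *ᵥ g.ofLp) ⬝ᵥ z.ofLp| ≤ n * L * ‖g‖ * ‖z‖ := by
  have hrow : ∀ i, |(M *ᵥ g.ofLp) i| ≤ L * ∑ j, |g j| := fun i => by
    rw [Matrix.mulVec, dotProduct, Finset.mul_sum]
    refine (Finset.abs_sum_le_sum_abs _ _).trans (Finset.sum_le_sum fun j _ => ?_)
    rw [abs_mul]
    exact mul_le_mul_of_nonneg_right (hM i j) (abs_nonneg _)
  calc |(M *ᵥ g.ofLp) ⬝ᵥ z.ofLp| ≤ ∑ i, (L * ∑ j, |g j|) * |z i| := by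
        rw [dotProduct]
        refine (Finset.abs_sum_le_sum_abs _ _).trans (Finset.sum_le_sum fun i _ => ?_)
        rw [abs_mul]
        exact mul_le_mul_of_nonneg_right (hrow i) (abs_nonneg _)
    _ = L * (∑ j, |g j|) * ∑ i, |z i| := (Finset.mul_sum _ _ _).symm
    _ ≤ L * (Real.sqrt n * ‖g‖) * (Real.sqrt n * ‖z‖) := by
        gcongr <;> exact sum_abs_le_sqrt_mul_norm _
    _ = (Real.sqrt n * Real.sqrt n) * L * ‖g‖ * ‖z‖ := by ring
    _ = n * L * ‖g‖ * ‖z‖ := by rw [Real.mul_self_sqrt (by positivity)]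

/-- The pointwise inequality behind the Caccioppoli estimate: `a ^ 2 • g + w • (2 * a) • z` is the
gradient of the test function `η² (u - k)⁺` with `a = η`, `w = (u - k)⁺`, `g = ∇(u - k)⁺` and
`z = ∇η`; the mixed terms are absorbed by Young's inequality. -/
theorem caccioppoli_pointwise {n : ℕ} {M : Matrix (Fin n) (Fin n) ℝ} {lam L : ℝ} (hlam : 0 < lam)
    (hL : 0 ≤ L) (hM : ∀ i j, |M i j| ≤ L) {g : EuclideanSpace ℝ (Fin n)}
    (hell : lam * ‖g‖ ^ 2 ≤ (M *ᵥ g.ofLp) ⬝ᵥ g.ofLp) (z Fx : EuclideanSpace ℝ (Fin n)) {a w : ℝ}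
    (ha : 0 ≤ a) (hw : 0 ≤ w) :
    lam / 2 * (a ^ 2 * ‖g‖ ^ 2) ≤
      (M *ᵥ g.ofLp) ⬝ᵥ (a ^ 2 • g + w • (2 * a) • z).ofLp
      + inner ℝ Fx (a ^ 2 • g + w • (2 * a) • z)
      + (4 * (n * L) ^ 2 / lam + 1) * (w ^ 2 * ‖z‖ ^ 2)
      + (1 / lam + 1) * (a ^ 2 * ‖Fx‖ ^ 2) := by
  have h1 : (M *ᵥ g.ofLp) ⬝ᵥ (a ^ 2 • g + w • (2 * a) • z).ofLp
      = a ^ 2 * ((M *ᵥ g.ofLp) ⬝ᵥ g.ofLp) + 2 * a * w * ((M *ᵥ g.ofLp) ⬝ᵥ z.ofLp) := by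
    simp only [WithLp.ofLp_add, WithLp.ofLp_smul, dotProduct_add, dotProduct_smul, smul_eq_mul]
    ring
  have h2 : inner ℝ Fx (a ^ 2 • g + w • (2 * a) • z)
      = a ^ 2 * inner ℝ Fx g + 2 * a * w * inner ℝ Fx z := by
    rw [inner_add_right, inner_smul_right, inner_smul_right, inner_smul_right]
    ring
  rw [h1, h2]
  have b1 := (abs_le.1 (abs_mulVec_dotProduct_le hL hM g z)).1
  have b2 := (abs_le.1 (abs_real_inner_le_norm Fx g)).1
  have b3 := (abs_le.1 (abs_real_inner_le_norm Fx z)).1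
  set m := (n : ℝ) * L with hm
  have y1 : 2 * a * w * (m * ‖g‖ * ‖z‖) ≤
      lam / 4 * (a ^ 2 * ‖g‖ ^ 2) + 4 * m ^ 2 / lam * (w ^ 2 * ‖z‖ ^ 2) := by
    have : lam / 4 * (a ^ 2 * ‖g‖ ^ 2) + 4 * m ^ 2 / lam * (w ^ 2 * ‖z‖ ^ 2)
        - 2 * a * w * (m * ‖g‖ * ‖z‖) = (lam * (a * ‖g‖) - 4 * m * (w * ‖z‖)) ^ 2 / (4 * lam) := by
      field_simp
      ring
    have h3 : 0 ≤ (lam * (a * ‖g‖) - 4 * m * (w * ‖z‖)) ^ 2 / (4 * lam) := by positivity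
    linarith
  have y2 : a ^ 2 * (‖Fx‖ * ‖g‖) ≤
      lam / 4 * (a ^ 2 * ‖g‖ ^ 2) + 1 / lam * (a ^ 2 * ‖Fx‖ ^ 2) := by
    have : lam / 4 * (a ^ 2 * ‖g‖ ^ 2) + 1 / lam * (a ^ 2 * ‖Fx‖ ^ 2) - a ^ 2 * (‖Fx‖ * ‖g‖)
        = a ^ 2 * (lam * ‖g‖ - 2 * ‖Fx‖) ^ 2 / (4 * lam) := by
      field_simp
      ring
    have h3 : 0 ≤ a ^ 2 * (lam * ‖g‖ - 2 * ‖Fx‖) ^ 2 / (4 * lam) := by positivity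
    linarith
  have y3 : 2 * a * w * (‖Fx‖ * ‖z‖) ≤ a ^ 2 * ‖Fx‖ ^ 2 + w ^ 2 * ‖z‖ ^ 2 := by
    nlinarith [sq_nonneg (a * ‖Fx‖ - w * ‖z‖)]
  have haw : 0 ≤ 2 * a * w := by positivity
  have c1 := mul_le_mul_of_nonneg_left b1 haw
  have c2 := mul_le_mul_of_nonneg_left b2 (sq_nonneg a)
  have c3 := mul_le_mul_of_nonneg_left b3 haw
  have c4 := mul_le_mul_of_nonneg_left hell (sq_nonneg a)
  linarith

theorem IsTestFunction.sq {n : ℕ} {Ω : Set (EuclideanSpace ℝ (Fin n))}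
    {η : EuclideanSpace ℝ (Fin n) → ℝ} (h : IsTestFunction Ω η) :
    IsTestFunction Ω (fun x => η x ^ 2) := by
  refine ⟨h.1.pow 2, ?_, ?_⟩ <;> simp only [pow_two]
  · exact h.2.1.mul_right
  · exact tsupport_mul_subset_left.trans h.2.2

theorem gradient_sq {n : ℕ} {η : EuclideanSpace ℝ (Fin n) → ℝ} (h : ContDiff ℝ ∞ η)
    (x : EuclideanSpace ℝ (Fin n)) :
    gradient (fun x => η x ^ 2) x = (2 * η x) • gradient η x := by
  have := ((h.hasGradientAt x).mul (h.hasGradientAt x)).gradient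
  simp only [pow_two]
  rw [this]
  module

theorem integrable_mulVec_dotProduct {n : ℕ} {α : Type*} [MeasurableSpace α] {μ : Measure α}
    {A : α → Matrix (Fin n) (Fin n) ℝ} {L : ℝ} (hA : ∀ i j, AEMeasurable (fun x => A x i j) μ)
    (hL : ∀ᵐ x ∂μ, ∀ i j, |A x i j| ≤ L) {G V : α → EuclideanSpace ℝ (Fin n)}
    (hG : MemLp G 2 μ) (hV : MemLp V 2 μ) :
    Integrable (fun x => (A x *ᵥ (G x).ofLp) ⬝ᵥ (V x).ofLp) μ := by
  simp only [Matrix.mulVec, dotProduct, Finset.sum_mul]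
  refine integrable_finsetSum _ fun i _ => integrable_finsetSum _ fun j _ => ?_
  have h1 := (hG.euclideanSpace_apply j).integrable_mul (hV.euclideanSpace_apply i)
  refine (h1.bdd_mul (c := L) (hA i j).aestronglyMeasurable ?_).congr
    (Eventually.of_forall fun x => ?_)
  · filter_upwards [hL] with x hx
    exact hx i j
  · simp [mul_assoc]

theorem MeasureTheory.MemLp.integrable_inner_two {n : ℕ} {α : Type*} [MeasurableSpace α]
    {μ : Measure α} {F V : α → EuclideanSpace ℝ (Fin n)} (hF : MemLp F 2 μ) (hV : MemLp V 2 μ) :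
    Integrable (fun x => inner ℝ (F x) (V x)) μ := by
  refine Integrable.mono' (hF.norm.integrable_mul hV.norm)
    (hF.aestronglyMeasurable.inner hV.aestronglyMeasurable) (Eventually.of_forall fun x => ?_)
  exact abs_real_inner_le_norm _ _

/-- **Caccioppoli inequality** for the truncation `(u - k)⁺` of a weak solution. -/
theorem caccioppoli {n : ℕ} {Ω : Set (EuclideanSpace ℝ (Fin n))} (hΩ : IsOpen Ω)
    {A : EuclideanSpace ℝ (Fin n) → Matrix (Fin n) (Fin n) ℝ} {lam Lam L : ℝ} (hlam : 0 < lam)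
    (hL : 0 ≤ L) (hA : IsUniformlyElliptic Ω A lam Lam L) {f u : EuclideanSpace ℝ (Fin n) → ℝ}
    {F G : EuclideanSpace ℝ (Fin n) → EuclideanSpace ℝ (Fin n)}
    (hF : MemLp F 2 (volume.restrict Ω)) (h : HasH1Gradient Ω u G) (hu : StronglyMeasurable u)
    (hG : StronglyMeasurable G)
    (hweak : ∀ v V, HasH10Gradient Ω v V →
      ∫ x in Ω, (A x *ᵥ (G x).ofLp) ⬝ᵥ (V x).ofLp =
        (∫ x in Ω, f x * v x) - ∫ x in Ω, inner ℝ (F x) (V x))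
    {η : EuclideanSpace ℝ (Fin n) → ℝ} (hη : IsTestFunction Ω η) (hη0 : ∀ x, 0 ≤ η x) (k : ℝ) :
    lam / 2 * ∫ x in Ω, ‖η x • {x | k < u x}.indicator G x‖ ^ 2 ≤
      (∫ x in Ω, f x * (η x ^ 2 * max (u x - k) 0))
      + (4 * (n * L) ^ 2 / lam + 1) * (∫ x in Ω, ‖max (u x - k) 0 • gradient η x‖ ^ 2)
      + (1 / lam + 1) * ∫ x in Ω, (η x * {x | k < u x}.indicator (fun x => ‖F x‖) x) ^ 2 := by
  set μ := (volume.restrict Ω : Measure (EuclideanSpace ℝ (Fin n))) with hμ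
  set S : Set (EuclideanSpace ℝ (Fin n)) := {x | k < u x} with hS
  have hSm : MeasurableSet S := measurableSet_lt measurable_const hu.measurable
  have hcut := h.hasH10Gradient_mul_truncation hΩ hu hG hη k
  have hv := h.hasH10Gradient_mul_truncation hΩ hu hG hη.sq k
  set V : EuclideanSpace ℝ (Fin n) → EuclideanSpace ℝ (Fin n) := fun x =>
    η x ^ 2 • S.indicator G x + max (u x - k) 0 • gradient (fun x => η x ^ 2) x with hV
  have hVL : MemLp V 2 μ := hv.hasH1Gradient.memLp_grad
  obtain ⟨a, ha⟩ := hη.2.1.exists_bound_of_continuous hη.continuous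
  have hGL : MemLp (fun x => η x • S.indicator G x) 2 μ := by
    refine h.memLp_grad.of_le_mul (c := a) (hη.continuous.stronglyMeasurable.smul
      (hG.indicator hSm)).aestronglyMeasurable (Eventually.of_forall fun x => ?_)
    rw [norm_smul]
    exact mul_le_mul (ha x) (norm_indicator_le_norm_self _ _) (norm_nonneg _)
      ((norm_nonneg _).trans (ha x))
  have hWL : MemLp (fun x => max (u x - k) 0 • gradient η x) 2 μ := by
    have := hcut.hasH1Gradient.memLp_grad.sub hGL
    refine this.ae_eq (Eventually.of_forall fun x => ?_)
    simp [hS]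
  have hFL : MemLp (fun x => η x * S.indicator (fun x => ‖F x‖) x) 2 μ := by
    refine hF.of_le_mul (c := a) (hη.continuous.aestronglyMeasurable.mul
      (hF.aestronglyMeasurable.norm.indicator hSm)) (Eventually.of_forall fun x => ?_)
    rw [norm_mul]
    refine mul_le_mul (ha x) ?_ (norm_nonneg _) ((norm_nonneg _).trans (ha x))
    exact (norm_indicator_le_norm_self _ _).trans_eq (norm_norm _)
  have iA := integrable_mulVec_dotProduct hA.aemeasurable hA.bounded h.memLp_grad hVL
  have iF := hF.integrable_inner_two hVL
  have iW := hWL.integrable_norm_pow two_ne_zero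
  have iG := hGL.integrable_norm_pow two_ne_zero
  have iFF := hFL.integrable_sq
  have hpt : ∀ᵐ x ∂μ, lam / 2 * ‖η x • S.indicator G x‖ ^ 2 ≤
      (A x *ᵥ (G x).ofLp) ⬝ᵥ (V x).ofLp + inner ℝ (F x) (V x)
      + (4 * (n * L) ^ 2 / lam + 1) * ‖max (u x - k) 0 • gradient η x‖ ^ 2
      + (1 / lam + 1) * (η x * S.indicator (fun x => ‖F x‖) x) ^ 2 := by
    filter_upwards [hA.elliptic, hA.bounded] with x hx1 hx2
    rw [hV]
    dsimp only
    rw [gradient_sq hη.1]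
    by_cases hx : x ∈ S
    · have hsq : ∀ (t : ℝ) (z : EuclideanSpace ℝ (Fin n)), ‖t • z‖ ^ 2 = t ^ 2 * ‖z‖ ^ 2 :=
        fun t z => by rw [norm_smul, mul_pow, Real.norm_eq_abs, sq_abs]
      rw [Set.indicator_of_mem hx, Set.indicator_of_mem hx, hsq, hsq, mul_pow (η x) ‖F x‖]
      exact caccioppoli_pointwise hlam hL hx2 (hx1 (G x)).1 _ _ (hη0 x) (le_max_right _ _)
    · have hx' : max (u x - k) 0 = 0 := max_eq_right (by simpa [hS] using hx)
      simp [hx, hx']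
  have hint := integral_mono_ae (iG.const_mul _)
    (((iA.add iF).add (iW.const_mul _)).add (iFF.const_mul _)) hpt
  rw [integral_const_mul, integral_add' ((iA.add iF).add (iW.const_mul _)) (iFF.const_mul _),
    integral_add' (iA.add iF) (iW.const_mul _), integral_add' iA iF, integral_const_mul,
    integral_const_mul, hweak _ _ hv] at hint
  linarith

/-- The absorption step: a Caccioppoli bound for the energy `I` and a Sobolev bound for the norm `T`
by the energy give a bound for `T` by the data. -/
theorem sq_le_of_energy_le {lam K c₁ c₂ I J P Q T b : ℝ} (hlam : 0 < lam) (hK : 0 < K)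
    (hc₁ : 0 < c₁) (hc₂ : 0 < c₂) (hJ : 0 ≤ J) (hQ : 0 ≤ Q)
    (h : lam / 2 * I ≤ P + c₁ * J + c₂ * Q) (hP : P ≤ b * T) (hT : T ^ 2 ≤ K * (I + J)) :
    T ^ 2 ≤ (2 * K * (1 + 2 * c₁ / lam) + 4 * K * c₂ / lam + (2 * K / lam) ^ 2) *
      (J + b ^ 2 + Q) := by
  have h1 : I ≤ 2 / lam * (b * T + c₁ * J + c₂ * Q) := by
    rw [div_mul_eq_mul_div, le_div_iff₀ hlam]
    linarith
  have h2 : T ^ 2 ≤ K * J + K * (2 / lam * (b * T + c₁ * J + c₂ * Q)) := by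
    nlinarith
  have h3 : K * (2 / lam * (b * T)) ≤ T ^ 2 / 2 + (2 * K / lam) ^ 2 * b ^ 2 / 2 := by
    have : K * (2 / lam * (b * T)) = (2 * K / lam * b) * T := by ring
    rw [this]
    nlinarith [sq_nonneg (2 * K / lam * b - T)]
  have h4 : T ^ 2 ≤ 2 * K * (1 + 2 * c₁ / lam) * J + 4 * K * c₂ / lam * Q
      + (2 * K / lam) ^ 2 * b ^ 2 := by
    have e : K * (2 / lam * (b * T + c₁ * J + c₂ * Q)) = K * (2 / lam * (b * T))
      + (2 * K * c₁ / lam) * J + (2 * K * c₂ / lam) * Q := by ring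
    have e2 : 2 * K * (1 + 2 * c₁ / lam) * J + 4 * K * c₂ / lam * Q
        = 2 * (K * J + (2 * K * c₁ / lam) * J + (2 * K * c₂ / lam) * Q) := by ring
    rw [e] at h2
    rw [e2]
    linarith
  refine h4.trans ?_
  have p1 : 0 ≤ 2 * K * (1 + 2 * c₁ / lam) := by positivity
  have p2 : 0 ≤ 4 * K * c₂ / lam := by positivity
  have p3 : 0 ≤ (2 * K / lam) ^ 2 := by positivity
  nlinarith [mul_nonneg p1 (sq_nonneg b), mul_nonneg p1 hQ, mul_nonneg p2 hJ,
    mul_nonneg p2 (sq_nonneg b), mul_nonneg p3 hJ, mul_nonneg p3 hQ]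

/-! ### The estimate on level sets -/

theorem Real.rpow_le_of_le_of_one_le {x X e : ℝ} (hx : 0 ≤ x) (hxX : x ≤ X) (hX : 1 ≤ X)
    (he : 0 ≤ e) (he1 : e ≤ 1) : x ^ e ≤ X :=
  (Real.rpow_le_rpow hx hxX he).trans (Real.rpow_le_self_of_one_le hX he1)

/-- The exponents of the measure of the level set, for the Sobolev exponent `s` with
`1 / s = (1 - 1 / n - 1 / q) / 2`: all terms carry at least the power `α` resp. `1 + α`, where
`α = 1 / n - 1 / q > 0`. -/
theorem levelSet_exponents {n q s x X J Nf NF Q : ℝ} (hn : 2 ≤ n) (hq : n < q)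
    (hs : 1 / s = (1 - 1 / n - 1 / q) / 2) (hx : 0 ≤ x) (hxX : x ≤ X) (hX : 1 ≤ X) (hJ : 0 ≤ J)
    (hQ : Q ≤ NF ^ 2 * x ^ (1 - 2 / q)) :
    (J + (Nf * x ^ (1 - 2 / q - 1 / s)) ^ 2 + Q) * x ^ (1 - 2 / s) ≤
      X * (J * x ^ (1 / n - 1 / q) + (Nf ^ 2 + NF ^ 2) * x ^ (1 + (1 / n - 1 / q))) := by
  have hn0 : 0 < n := by linarith
  have hq0 : 0 < q := by linarith
  have hα : 0 < 1 / n - 1 / q := sub_pos.2 (one_div_lt_one_div_of_lt hn0 hq)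
  have hn2 : 1 / n ≤ 1 / 2 := one_div_le_one_div_of_le two_pos hn
  have hqpos : 0 < 1 / q := by positivity
  have hq2 : 2 / q = 2 * (1 / q) := by ring
  have hs2 : 1 - 2 / s = (1 / n - 1 / q) + 2 / q := by
    have : 2 / s = 2 * (1 / s) := by ring
    rw [this, hs]
    ring
  set α := 1 / n - 1 / q with hαdef
  have hxα : 0 ≤ x ^ α := by positivity
  have hxα1 : 0 ≤ x ^ (1 + α) := by positivity
  have e1 : x ^ (1 - 2 / s) ≤ X * x ^ α := by
    rw [hs2, Real.rpow_add_of_nonneg hx hα.le (by positivity), mul_comm]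
    gcongr
    exact Real.rpow_le_of_le_of_one_le hx hxX hX (by positivity) (by linarith)
  have e2 : (x ^ (1 - 2 / q - 1 / s)) ^ 2 * x ^ (1 - 2 / s) ≤ X * x ^ (1 + α) := by
    rw [← Real.rpow_mul_natCast hx, ← Real.rpow_add_of_nonneg hx]
    · have : (1 - 2 / q - 1 / s) * ((2 : ℕ) : ℝ) + (1 - 2 / s) = α + (1 + α) := by
        rw [hs2, hs, hαdef]
        push_cast
        ring
      rw [this, Real.rpow_add_of_nonneg hx hα.le (by positivity)]
      gcongr
      exact Real.rpow_le_of_le_of_one_le hx hxX hX hα.le (by linarith)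
    · rw [hs, hq2]
      push_cast
      linarith
    · rw [hs2]
      positivity
  have e3 : x ^ (1 - 2 / q) * x ^ (1 - 2 / s) ≤ X * x ^ (1 + α) := by
    rw [← Real.rpow_add_of_nonneg hx (by linarith) (by rw [hs2]; positivity), hs2,
      show 1 - 2 / q + (α + 2 / q) = 1 + α by ring]
    exact le_mul_of_one_le_left hxα1 hX
  have hpos : 0 ≤ x ^ (1 - 2 / s) := by positivity
  calc (J + (Nf * x ^ (1 - 2 / q - 1 / s)) ^ 2 + Q) * x ^ (1 - 2 / s)
      ≤ (J + (Nf * x ^ (1 - 2 / q - 1 / s)) ^ 2 + NF ^ 2 * x ^ (1 - 2 / q)) * x ^ (1 - 2 / s) := by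
        gcongr
    _ = J * x ^ (1 - 2 / s) + Nf ^ 2 * ((x ^ (1 - 2 / q - 1 / s)) ^ 2 * x ^ (1 - 2 / s))
        + NF ^ 2 * (x ^ (1 - 2 / q) * x ^ (1 - 2 / s)) := by ring
    _ ≤ J * (X * x ^ α) + Nf ^ 2 * (X * x ^ (1 + α)) + NF ^ 2 * (X * x ^ (1 + α)) := by
        gcongr
    _ = _ := by ring

theorem combine_levelSet_bounds {l t y C E X J z₁ N z₂ D a : ℝ} (hC : 0 < C) (hX : 0 ≤ X)
    (hD : 1 ≤ D) (hy : 0 ≤ y) (hz₁ : 0 ≤ z₁) (hN : 0 ≤ N) (hz₂ : 0 ≤ z₂) (h1 : l ≤ t * y)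
    (h2 : t ≤ C * E) (h3 : E * y ≤ X * (J * z₁ + N * z₂)) (h4 : J ≤ D * a) :
    l ≤ C * X * D * (a * z₁ + N * z₂) :=
  calc l ≤ C * E * y := h1.trans (by gcongr)
    _ ≤ C * (X * (J * z₁ + N * z₂)) := by
      rw [mul_assoc]
      gcongr
    _ ≤ C * (X * (D * a * z₁ + D * (N * z₂))) := by
      refine mul_le_mul_of_nonneg_left (mul_le_mul_of_nonneg_left (add_le_add ?_ ?_) hX) hC.le
      · gcongr
      · exact le_mul_of_one_le_left (by positivity) hD
    _ = _ := by ring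

set_option maxHeartbeats 1000000 in
/-- De Giorgi's estimate: the `L²` norm of `(u - k)⁺` on a smaller ball is bounded by a higher power
of the data on a larger one, the gain `α = 1 / n - 1 / q` being carried by the measure of the level
set. -/
theorem exists_levelSet_estimate {n : ℕ} (hn : 2 ≤ n) {q : ℝ} (hq : (n : ℝ) < q) (R : ℝ)
    {lam L : ℝ} (hlam : 0 < lam) (hL : 0 < L) :
    ∃ C : ℝ, 0 < C ∧ ∀ (Lam : ℝ) (A : EuclideanSpace ℝ (Fin n) → Matrix (Fin n) (Fin n) ℝ)
      (f u : EuclideanSpace ℝ (Fin n) → ℝ)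
      (F G : EuclideanSpace ℝ (Fin n) → EuclideanSpace ℝ (Fin n)),
      IsUniformlyElliptic (Metric.ball 0 R) A lam Lam L →
      MemLp f (ENNReal.ofReal (q / 2)) (volume.restrict (Metric.ball 0 R)) →
      MemLp F (ENNReal.ofReal q) (volume.restrict (Metric.ball 0 R)) →
      HasH1Gradient (Metric.ball 0 R) u G → StronglyMeasurable u → StronglyMeasurable G →
      (∀ v V, HasH10Gradient (Metric.ball 0 R) v V →
        ∫ x in Metric.ball 0 R, (A x *ᵥ (G x).ofLp) ⬝ᵥ (V x).ofLp =
          (∫ x in Metric.ball 0 R, f x * v x) - ∫ x in Metric.ball 0 R, inner ℝ (F x) (V x)) →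
      ∀ k ρ σ : ℝ, 0 < ρ → ρ < σ → σ ≤ R →
        ∫ x in Metric.ball 0 ρ, (max (u x - k) 0) ^ 2 ≤
          C * ((∫ x in Metric.ball 0 σ, (max (u x - k) 0) ^ 2) / (σ - ρ) ^ 2 *
              volume.real (Metric.ball 0 σ ∩ {x | k < u x}) ^ (1 / (n : ℝ) - 1 / q) +
            ((eLpNorm f (ENNReal.ofReal (q / 2)) (volume.restrict (Metric.ball 0 R))).toReal ^ 2 +
              (eLpNorm F (ENNReal.ofReal q) (volume.restrict (Metric.ball 0 R))).toReal ^ 2) *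
              volume.real (Metric.ball 0 σ ∩ {x | k < u x}) ^ (1 + (1 / (n : ℝ) - 1 / q))) := by
  have hn' : (2 : ℝ) ≤ n := by exact_mod_cast hn
  have hn0 : (0 : ℝ) < n := by linarith
  have hq0 : 0 < q := by linarith
  have hqn : 1 / q < 1 / (n : ℝ) := one_div_lt_one_div_of_lt hn0 hq
  have hqpos : 0 < 1 / q := by positivity
  have hn2 : 1 / (n : ℝ) ≤ 1 / 2 := one_div_le_one_div_of_le two_pos hn'
  -- A subcritical Sobolev exponent: `1 / s` lies halfway between the critical value `1 / 2 - 1 / n`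
  -- and the bound `1 / 2 - 1 / q` that the exponents of the data impose.
  set s : ℝ := ((1 - 1 / n - 1 / q) / 2)⁻¹ with hsdef
  have hsinv : 1 / s = (1 - 1 / n - 1 / q) / 2 := by rw [hsdef, one_div, inv_inv]
  have hspos' : 0 < (1 - 1 / (n : ℝ) - 1 / q) / 2 := by linarith
  have hs0 : 0 < s := inv_pos.2 hspos'
  have hs2 : 2 ≤ s := by
    rw [hsdef, le_inv_comm₀ two_pos hspos']
    linarith
  -- The exponent `t < 2` whose critical Sobolev exponent is `s`.
  set t : ℝ := ((1 + 1 / n - 1 / q) / 2)⁻¹ with htdef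
  have htpos' : 0 < (1 + 1 / (n : ℝ) - 1 / q) / 2 := by linarith
  have ht0 : 0 < t := inv_pos.2 htpos'
  have ht1 : 1 ≤ t := by
    rw [htdef, one_le_inv₀ htpos']
    linarith
  have ht2 : t < 2 := by
    rw [htdef, inv_lt_comm₀ htpos' two_pos]
    linarith
  obtain ⟨C₀, hC₀⟩ := HasH10Gradient.exists_eLpNorm_le hn
    (Metric.isBounded_ball (x := (0 : EuclideanSpace ℝ (Fin n))) (r := R))
    (s := s.toNNReal) (t := t.toNNReal)
    (by rw [← NNReal.coe_le_coe, Real.coe_toNNReal _ ht0.le]; exact ht1)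
    (by rw [← NNReal.coe_lt_coe, Real.coe_toNNReal _ ht0.le]; exact ht2)
    (by
      rw [Real.coe_toNNReal _ ht0.le, Real.coe_toNNReal _ hs0.le, hsdef, htdef, inv_inv, inv_inv]
      ring)
  obtain ⟨c, hc0, hcut⟩ := exists_cutoff
  set X : ℝ := max (volume.real (Metric.ball (0 : EuclideanSpace ℝ (Fin n)) R)) 1 with hXdef
  set K : ℝ := 2 * (C₀ : ℝ) ^ 2 + 1 with hK
  set c₁ : ℝ := 4 * (n * L) ^ 2 / lam + 1 with hc₁
  set c₂ : ℝ := 1 / lam + 1 with hc₂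
  set C₁ : ℝ := 2 * K * (1 + 2 * c₁ / lam) + 4 * K * c₂ / lam + (2 * K / lam) ^ 2 with hC₁
  have hKpos : 0 < K := by positivity
  have hc₁pos : 0 < c₁ := by positivity
  have hc₂pos : 0 < c₂ := by positivity
  have hC₁pos : 0 < C₁ := by positivity
  have hX1 : 1 ≤ X := le_max_right _ _
  set D : ℝ := (2 * c) ^ 2 + 1 with hD
  refine ⟨C₁ * X * D, by positivity, ?_⟩
  intro Lam A f u F G hA hf hF h hu hG hweak k ρ σ hρ hρσ hσR
  set μ := (volume.restrict (Metric.ball 0 R) : Measure (EuclideanSpace ℝ (Fin n))) with hμ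
  have : IsFiniteMeasure μ := ⟨by
    rw [hμ, Measure.restrict_apply_univ]
    exact measure_ball_lt_top⟩
  set S : Set (EuclideanSpace ℝ (Fin n)) := Metric.ball 0 σ ∩ {x | k < u x} with hS
  set w : EuclideanSpace ℝ (Fin n) → ℝ := fun x => max (u x - k) 0 with hw
  have hw0 : ∀ x, 0 ≤ w x := fun x => le_max_right _ _
  have hwm : StronglyMeasurable w := (hu.sub stronglyMeasurable_const).sup stronglyMeasurable_const
  have hwS : ∀ x, ¬ k < u x → w x = 0 := fun x hx => max_eq_right (by linarith [not_lt.1 hx])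
  have hkm : MeasurableSet {x | k < u x} := measurableSet_lt measurable_const hu.measurable
  have hSm : MeasurableSet S := Metric.isOpen_ball.measurableSet.inter hkm
  have hSR : S ⊆ Metric.ball 0 R := fun x hx => Metric.ball_subset_ball hσR hx.1
  have hμS : μ.real S = volume.real S := by
    rw [hμ, measureReal_restrict_apply hSm, Set.inter_eq_left.2 hSR]
  set x := volume.real S with hx
  have hx0 : 0 ≤ x := measureReal_nonneg
  have hxX : x ≤ X := (measureReal_mono hSR measure_ball_lt_top.ne).trans (le_max_left _ _)
  obtain ⟨η, hηs, hη0, hη1, hηρ, hηsupp, hηgrad⟩ := hcut n ρ ((ρ + σ) / 2) hρ (by linarith)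
  have hηsuppσ : tsupport η ⊆ Metric.ball 0 σ :=
    hηsupp.trans (Metric.closedBall_subset_ball (by linarith))
  have hη : IsTestFunction (Metric.ball 0 R) η :=
    ⟨hηs, (isCompact_closedBall _ _).of_isClosed_subset (isClosed_tsupport η) hηsupp,
      hηsuppσ.trans (Metric.ball_subset_ball hσR)⟩
  have hησ : ∀ x ∉ Metric.ball 0 σ, η x = 0 := fun x hx =>
    image_eq_zero_of_notMem_tsupport fun h' => hx (hηsuppσ h')
  have hησ' : ∀ x ∉ Metric.ball 0 σ, gradient η x = 0 := fun x hx =>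
    gradient_eq_zero_of_notMem_tsupport fun h' => hx (hηsuppσ h')
  have hcutS : ∀ x ∉ S, η x * w x = 0 := by
    intro x hx
    by_cases h1 : x ∈ Metric.ball 0 σ
    · rw [hwS x fun h2 => hx ⟨h1, h2⟩, mul_zero]
    · rw [hησ x h1, zero_mul]
  -- The Sobolev inequality for `η w`.
  have hv := h.hasH10Gradient_mul_truncation Metric.isOpen_ball hu hG hη k
  set V : EuclideanSpace ℝ (Fin n) → EuclideanSpace ℝ (Fin n) := fun x =>
    η x • {x | k < u x}.indicator G x + max (u x - k) 0 • gradient η x with hV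
  have hVL : MemLp V 2 μ := hv.hasH1Gradient.memLp_grad
  have hsob := hC₀ _ _ hv
  change eLpNorm (fun x => η x * w x) (ENNReal.ofReal s) μ ≤ _ at hsob
  have hvs : MemLp (fun x => η x * w x) (ENNReal.ofReal s) μ :=
    ⟨hv.hasH1Gradient.memLp.aestronglyMeasurable,
      hsob.trans_lt (ENNReal.mul_lt_top ENNReal.coe_lt_top hVL.eLpNorm_lt_top)⟩
  set T := (eLpNorm (fun x => η x * w x) (ENNReal.ofReal s) μ).toReal with hT
  set I := ∫ x, ‖η x • {x | k < u x}.indicator G x‖ ^ 2 ∂μ with hI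
  set J := ∫ x, ‖max (u x - k) 0 • gradient η x‖ ^ 2 ∂μ with hJ
  have hGL : MemLp (fun x => η x • {x | k < u x}.indicator G x) 2 μ := by
    refine h.memLp_grad.of_le (hη.continuous.stronglyMeasurable.smul
      (hG.indicator hkm)).aestronglyMeasurable (Eventually.of_forall fun x => ?_)
    rw [norm_smul, Real.norm_of_nonneg (hη0 x)]
    exact (mul_le_of_le_one_left (norm_nonneg _) (hη1 x)).trans (norm_indicator_le_norm_self _ _)
  have hWL : MemLp (fun x => max (u x - k) 0 • gradient η x) 2 μ := by
    refine (hVL.sub hGL).ae_eq (Eventually.of_forall fun x => ?_)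
    simp [hV]
  have hTIJ : T ^ 2 ≤ K * (I + J) := by
    have h1 : T ≤ C₀ * (eLpNorm V 2 μ).toReal := by
      have := ENNReal.toReal_mono (ENNReal.mul_ne_top ENNReal.coe_ne_top hVL.eLpNorm_ne_top) hsob
      rwa [ENNReal.toReal_mul, ENNReal.coe_toReal] at this
    have h2 : (eLpNorm V 2 μ).toReal ^ 2 ≤ 2 * (I + J) := by
      rw [toReal_eLpNorm_two_sq hVL.aestronglyMeasurable, hI, hJ,
        ← integral_add (hGL.integrable_norm_pow two_ne_zero) (hWL.integrable_norm_pow two_ne_zero),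
        ← integral_const_mul]
      refine integral_mono (hVL.integrable_norm_pow two_ne_zero)
        (((hGL.integrable_norm_pow two_ne_zero).add
          (hWL.integrable_norm_pow two_ne_zero)).const_mul _) fun x => ?_
      have h3 := norm_add_le (η x • {x | k < u x}.indicator G x) (max (u x - k) 0 • gradient η x)
      have h4 := pow_le_pow_left₀ (norm_nonneg _) h3 2
      exact h4.trans add_sq_le
    have hIJ : 0 ≤ I + J := add_nonneg (integral_nonneg fun _ => by positivity)
      (integral_nonneg fun _ => by positivity)
    calc T ^ 2 ≤ (C₀ * (eLpNorm V 2 μ).toReal) ^ 2 :=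
          pow_le_pow_left₀ ENNReal.toReal_nonneg h1 2
      _ = (C₀ : ℝ) ^ 2 * (eLpNorm V 2 μ).toReal ^ 2 := mul_pow _ _ _
      _ ≤ (C₀ : ℝ) ^ 2 * (2 * (I + J)) := by gcongr
      _ ≤ K * (I + J) := by
        rw [hK]
        linarith
  have hF2 : MemLp F 2 μ := hF.mono_exponent (by
    rw [← ENNReal.ofReal_ofNat]
    exact ENNReal.ofReal_le_ofReal (by linarith))
  have hcac := caccioppoli Metric.isOpen_ball hlam hL.le hA hF2 h hu hG hweak hη hη0 k
  set P := ∫ x, f x * (η x ^ 2 * max (u x - k) 0) ∂μ with hP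
  set Q := ∫ x, (η x * {x | k < u x}.indicator (fun x => ‖F x‖) x) ^ 2 ∂μ with hQ
  set Nf := (eLpNorm f (ENNReal.ofReal (q / 2)) μ).toReal with hNf
  set NF := (eLpNorm F (ENNReal.ofReal q) μ).toReal with hNF
  have hPle : P ≤ Nf * x ^ (1 - 2 / q - 1 / s) * T := by
    have h1 := abs_integral_le_of_support_subset (μ := μ) (S := S) (measure_ne_top _ _)
      (half_pos hq0) hs0 (by rw [hsinv, one_div_div, show 2 / q = 2 * (1 / q) by ring]; linarith)
      hf hvs (h := fun x => f x * (η x ^ 2 * max (u x - k) 0)) (fun x => ?_) (fun x hx => ?_)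
    · rw [hμS, one_div_div] at h1
      calc P ≤ _ := le_abs_self _
        _ ≤ _ := h1
        _ = _ := by ring
    · rw [abs_mul]
      refine mul_le_mul_of_nonneg_left ?_ (abs_nonneg _)
      rw [abs_of_nonneg (mul_nonneg (hη0 x) (hw0 x)),
        abs_of_nonneg (mul_nonneg (sq_nonneg _) (hw0 x)), pow_two, mul_assoc]
      exact mul_le_of_le_one_left (mul_nonneg (hη0 x) (hw0 x)) (hη1 x)
    · have : η x ^ 2 * max (u x - k) 0 = η x * (η x * w x) := by rw [hw]; ring
      rw [this, hcutS x hx, mul_zero, mul_zero]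
  have hQle : Q ≤ NF ^ 2 * x ^ (1 - 2 / q) := by
    have h1 := integral_norm_sq_le_of_support_subset (μ := μ) (S := S) (measure_ne_top _ _)
      (show 2 ≤ q by linarith) hF (h := fun x => η x * {x | k < u x}.indicator (fun x => ‖F x‖) x)
      (hη.continuous.aestronglyMeasurable.mul (hF.aestronglyMeasurable.norm.indicator hkm))
      (fun x => ?_) (fun x hx => ?_)
    · rwa [hμS] at h1
    · rw [abs_mul, abs_of_nonneg (hη0 x)]
      refine (mul_le_of_le_one_left (abs_nonneg _) (hη1 x)).trans ?_
      exact (norm_indicator_le_norm_self (fun x => ‖F x‖) x).trans_eq (norm_norm _)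
    · by_cases h1 : x ∈ Metric.ball 0 σ
      · have : x ∉ {x | k < u x} := fun h2 => hx ⟨h1, h2⟩
        rw [Set.indicator_of_notMem this, mul_zero]
      · rw [hησ x h1, zero_mul]
  have hJ0 : 0 ≤ J := integral_nonneg fun _ => by positivity
  have hQ0 : 0 ≤ Q := integral_nonneg fun _ => by positivity
  have hT2 := sq_le_of_energy_le hlam hKpos hc₁pos hc₂pos hJ0 hQ0 hcac hPle hTIJ
  rw [← hC₁] at hT2
  -- Back from the Sobolev norm to the `L²` norm.
  have hL2 : ∫ x, (η x * w x) ^ 2 ∂μ ≤ T ^ 2 * x ^ (1 - 2 / s) := by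
    have h1 := integral_norm_sq_le_of_support_subset (μ := μ) (S := S) (measure_ne_top _ _)
      hs2 hvs hvs.aestronglyMeasurable (fun x => le_rfl) hcutS
    rwa [hμS] at h1
  have hwL : MemLp w 2 μ := by
    refine ((h.memLp.sub (memLp_const k)).norm).of_le hwm.aestronglyMeasurable
      (Eventually.of_forall fun x => ?_)
    rw [norm_norm, Real.norm_of_nonneg (hw0 x)]
    exact max_le (le_abs_self _) (abs_nonneg _)
  have hwint : IntegrableOn (fun x => w x ^ 2) (Metric.ball 0 R) volume := hwL.integrable_sq
  have hvint : IntegrableOn (fun x => (η x * w x) ^ 2) (Metric.ball 0 R) volume :=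
    hv.hasH1Gradient.memLp.integrable_sq
  have hleft : ∫ x in Metric.ball 0 ρ, w x ^ 2 ≤ ∫ x, (η x * w x) ^ 2 ∂μ := by
    calc ∫ x in Metric.ball 0 ρ, w x ^ 2 = ∫ x in Metric.ball 0 ρ, (η x * w x) ^ 2 :=
          setIntegral_congr_fun Metric.isOpen_ball.measurableSet fun x hx => by
            simp only [hηρ x hx, one_mul]
      _ ≤ _ := setIntegral_mono_set hvint (Eventually.of_forall fun x => sq_nonneg _)
          (Metric.ball_subset_ball (hρσ.le.trans hσR)).eventuallyLE
  set a := ∫ x in Metric.ball 0 σ, w x ^ 2 with ha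
  have ha0 : 0 ≤ a := integral_nonneg fun _ => sq_nonneg _
  have hd : 0 < σ - ρ := sub_pos.2 hρσ
  have hJle : J ≤ D * (a / (σ - ρ) ^ 2) := by
    have h1 : J = ∫ x in Metric.ball 0 σ, ‖max (u x - k) 0 • gradient η x‖ ^ 2 := by
      have h2 : ∀ x ∉ Metric.ball 0 σ, ‖max (u x - k) 0 • gradient η x‖ ^ 2 = 0 := fun x hx => by
        simp [hησ' x hx]
      rw [hJ, hμ, setIntegral_eq_integral_of_forall_compl_eq_zero h2,
        setIntegral_eq_integral_of_forall_compl_eq_zero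
          fun x hx => h2 x fun h3 => hx (Metric.ball_subset_ball hσR h3)]
    have h2 : J ≤ ∫ x in Metric.ball 0 σ, (2 * c / (σ - ρ)) ^ 2 * w x ^ 2 := by
      rw [h1]
      refine integral_mono
        (IntegrableOn.mono_set (hWL.integrable_norm_pow two_ne_zero) (Metric.ball_subset_ball hσR))
        ((hwint.mono_set (Metric.ball_subset_ball hσR)).const_mul _) fun x => ?_
      dsimp only
      rw [norm_smul, mul_pow, mul_comm, Real.norm_of_nonneg (hw0 x)]
      gcongr
      refine (hηgrad x).trans_eq ?_
      rw [show (ρ + σ) / 2 - ρ = (σ - ρ) / 2 by ring, div_div_eq_mul_div, mul_comm]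
    rw [integral_const_mul, ← ha] at h2
    refine h2.trans ?_
    rw [div_pow, hD, div_mul_eq_mul_div, mul_div_assoc]
    gcongr
    linarith
  have hexp := levelSet_exponents (Nf := Nf) hn' hq hsinv hx0 hxX hX1 hJ0 hQle
  have hD1 : 1 ≤ D := by
    rw [hD]
    nlinarith [sq_nonneg (2 * c)]
  exact combine_levelSet_bounds hC₁pos (by linarith) hD1 (by positivity) (by positivity)
    (by positivity) (by positivity) (hleft.trans hL2) hT2 hexp hJle

/-! ### The iteration -/

/-- Fast geometric convergence: a superlinear recursion with exponentially growing coefficients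
forces geometric decay once the initial value is small. -/
theorem le_mul_pow_of_superlinear {y : ℕ → ℝ} {C b α δ θ : ℝ} (hy : ∀ j, 0 ≤ y j) (hC : 0 < C)
    (hb : 0 < b) (hα : 0 < α) (hδ : 0 < δ) (hθ : 0 < θ) (hbθ : b * θ ^ α ≤ 1)
    (hCδ : C * δ ^ α ≤ θ) (h0 : y 0 ≤ δ)
    (hstep : ∀ j, y (j + 1) ≤ C * b ^ j * y j ^ (1 + α)) (j : ℕ) : y j ≤ δ * θ ^ j := by
  induction j with
  | zero => simpa using h0
  | succ j ih =>
    have hpos : 0 < δ * θ ^ j := by positivity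
    calc y (j + 1) ≤ C * b ^ j * y j ^ (1 + α) := hstep j
      _ ≤ C * b ^ j * (δ * θ ^ j) ^ (1 + α) := by
        gcongr
        exact hy j
      _ = C * δ ^ α * (b * θ ^ α) ^ j * (δ * θ ^ j) := by
        rw [Real.rpow_add hpos, Real.rpow_one, Real.mul_rpow hδ.le (by positivity), mul_pow,
          ← Real.rpow_natCast_mul hθ.le, ← Real.rpow_mul_natCast hθ.le, mul_comm (j : ℝ) α]
        ring
      _ ≤ θ * 1 * (δ * θ ^ j) := by
        gcongr
        exact pow_le_one₀ (by positivity) hbθ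
      _ = δ * θ ^ (j + 1) := by ring

/-- The De Giorgi iteration, for a quantity `a k ρ` standing for the integral of `((u - k)⁺)²` over
the ball of radius `ρ` and `m k ρ` for the measure of the part of that ball where `u > k`. The
levels increase to `K M` while the radii decrease from `R` to `r`. -/
theorem exists_deGiorgi_level {α C₀ r R : ℝ} (hα : 0 < α) (hC₀ : 0 < C₀) (hr : 0 < r)
    (hrR : r < R) :
    ∃ K : ℝ, 0 < K ∧ ∀ (a m : ℝ → ℝ → ℝ) (M : ℝ), 0 < M → (∀ k ρ, 0 ≤ a k ρ) →
      (∀ k ρ, 0 ≤ m k ρ) →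
      (∀ k l ρ σ, k ≤ l → ρ ≤ σ → σ ≤ R → a l ρ ≤ a k σ) →
      (∀ k l σ, k < l → σ ≤ R → (l - k) ^ 2 * m l σ ≤ a k σ) →
      (∀ k ρ σ, 0 < ρ → ρ < σ → σ ≤ R →
        a k ρ ≤ C₀ * (a k σ / (σ - ρ) ^ 2 * m k σ ^ α + 2 * M ^ 2 * m k σ ^ (1 + α))) →
      a 0 R ≤ M ^ 2 → a (K * M) r = 0 := by
  have hd : 0 < R - r := sub_pos.2 hrR
  -- Halving the gaps of levels and radii costs a factor `4` in each of their squares, hence the base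
  -- `4 ^ (1 + α)` of the recursion.
  set b : ℝ := 4 ^ (1 + α) with hb
  have hb0 : 0 < b := by positivity
  have hb1 : 1 < b := Real.one_lt_rpow (by norm_num) (by linarith)
  set C : ℝ := C₀ * (1 / (R - r) ^ 2 + 2) * b with hC
  have hCpos : 0 < C := by positivity
  -- The decay rate `θ` and the threshold `δ` are the solutions of `b θ ^ α = 1` and `C δ ^ α = θ`.
  set θ : ℝ := b ^ (-(1 / α)) with hθ
  have hθ0 : 0 < θ := by positivity
  have hθ1 : θ < 1 := Real.rpow_lt_one_of_one_lt_of_neg hb1 (by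
    rw [neg_lt_zero]
    positivity)
  have hbθ : b * θ ^ α = 1 := by
    rw [hθ, ← Real.rpow_mul hb0.le, neg_mul, one_div_mul_cancel hα.ne', Real.rpow_neg_one,
      mul_inv_cancel₀ hb0.ne']
  set δ : ℝ := (θ / C) ^ (1 / α) with hδ
  have hδ0 : 0 < δ := by positivity
  have hCδ : C * δ ^ α = θ := by
    rw [hδ, ← Real.rpow_mul (by positivity), one_div_mul_cancel hα.ne', Real.rpow_one,
      mul_div_cancel₀ _ hCpos.ne']
  set K : ℝ := 1 + 1 / δ with hK
  have hK0 : 0 < K := by positivity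
  have hK1 : 1 ≤ K := by
    rw [hK]
    linarith [one_div_pos.2 hδ0]
  have hKδ : 1 ≤ K ^ 2 * δ := by
    have h1 : 1 ≤ K * δ := by
      rw [hK, add_mul, one_mul, one_div_mul_cancel hδ0.ne']
      linarith
    nlinarith
  refine ⟨K, hK0, fun a m M hM ha hm hmono hcheb hmain h0 => ?_⟩
  set kk : ℕ → ℝ := fun j => K * M * (1 - 1 / 2 ^ j) with hkk
  set rr : ℕ → ℝ := fun j => r + (R - r) / 2 ^ j with hrr
  have hKM : 0 < K * M := by positivity
  have hrr0 : ∀ j, r < rr j := fun j => lt_add_of_pos_right _ (by positivity)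
  have hrrR : ∀ j, rr j ≤ R := fun j => by
    have : (R - r) / 2 ^ j ≤ R - r := div_le_self hd.le (one_le_pow₀ (by norm_num))
    simp only [hrr]
    linarith
  have hrrd : ∀ j, rr j - rr (j + 1) = (R - r) / 2 ^ (j + 1) := fun j => by
    simp only [hrr, pow_succ]
    field_simp
    ring
  have hkkd : ∀ j, kk (j + 1) - kk j = K * M / 2 ^ (j + 1) := fun j => by
    simp only [hkk, pow_succ]
    field_simp
    ring
  have hkkle : ∀ j, kk j ≤ K * M := fun j => by
    refine mul_le_of_le_one_right hKM.le ?_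
    have : (0 : ℝ) < 1 / 2 ^ j := by positivity
    linarith
  set y : ℕ → ℝ := fun j => a (kk j) (rr j) / (K * M) ^ 2 with hy
  have hy0 : ∀ j, 0 ≤ y j := fun j => div_nonneg (ha _ _) (sq_nonneg _)
  have hya : ∀ j, a (kk j) (rr j) = (K * M) ^ 2 * y j := fun j => by
    simp only [hy]
    field_simp
  have hstep : ∀ j, y (j + 1) ≤ C * b ^ j * y j ^ (1 + α) := by
    intro j
    have hrlt : rr (j + 1) < rr j := by
      have := hrrd j
      have h2 : 0 < (R - r) / 2 ^ (j + 1) := by positivity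
      linarith
    have hklt : kk j < kk (j + 1) := by
      have := hkkd j
      have h2 : 0 < K * M / 2 ^ (j + 1) := by positivity
      linarith
    have h1 := hmain (kk (j + 1)) (rr (j + 1)) (rr j) (hr.trans (hrr0 _)) hrlt (hrrR j)
    have h2 := hmono (kk j) (kk (j + 1)) (rr j) (rr j) hklt.le le_rfl (hrrR j)
    have h3 := hcheb (kk j) (kk (j + 1)) (rr j) hklt (hrrR j)
    set x := m (kk (j + 1)) (rr j) with hx
    have hx0 : 0 ≤ x := hm _ _
    set e : ℝ := 4 ^ (j + 1) with he
    have he0 : 0 < e := by positivity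
    have he2 : ((2 : ℝ) ^ (j + 1)) ^ 2 = e := by
      rw [he, ← pow_mul, mul_comm, pow_mul]
      norm_num
    rw [hrrd, hya, div_pow, he2] at h1
    rw [hya] at h2
    rw [hkkd, hya, div_pow, he2] at h3
    have hxle : x ≤ e * y j := by
      have : (K * M) ^ 2 / e * x = (K * M) ^ 2 * (x / e) := by ring
      rw [this] at h3
      have h4 := le_of_mul_le_mul_left h3 (by positivity)
      rwa [div_le_iff₀ he0, mul_comm] at h4
    have hxα : x ^ α ≤ (e * y j) ^ α := Real.rpow_le_rpow hx0 hxle hα.le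
    have hxα1 : x ^ (1 + α) ≤ (e * y j) ^ (1 + α) := Real.rpow_le_rpow hx0 hxle (by positivity)
    have hey : 0 ≤ e * y j := mul_nonneg he0.le (hy0 j)
    have hsplit : e * y j * (e * y j) ^ α = (e * y j) ^ (1 + α) := by
      rw [Real.rpow_add_of_nonneg hey zero_le_one hα.le, Real.rpow_one]
    have hbe : (e * y j) ^ (1 + α) = b * b ^ j * y j ^ (1 + α) := by
      rw [Real.mul_rpow he0.le (hy0 j), he, hb, ← Real.rpow_natCast_mul (by norm_num),
        mul_comm ((j + 1 : ℕ) : ℝ), Real.rpow_mul_natCast (by norm_num), pow_succ']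
    have hMK : M ^ 2 ≤ (K * M) ^ 2 := by
      rw [mul_pow]
      exact le_mul_of_one_le_left (sq_nonneg _) (one_le_pow₀ hK1)
    have hz : 0 ≤ (e * y j) ^ (1 + α) := by positivity
    have hfinal : (K * M) ^ 2 * y (j + 1) ≤ (K * M) ^ 2 * (C * b ^ j * y j ^ (1 + α)) :=
      calc (K * M) ^ 2 * y (j + 1)
          ≤ C₀ * ((K * M) ^ 2 * y j / ((R - r) ^ 2 / e) * (e * y j) ^ α
            + 2 * (K * M) ^ 2 * (e * y j) ^ (1 + α)) := by
            refine h1.trans ?_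
            gcongr
            exact div_nonneg (mul_nonneg (by positivity) (hy0 j)) (by positivity)
        _ = (K * M) ^ 2 * (C₀ * (1 / (R - r) ^ 2 * (e * y j * (e * y j) ^ α)
            + 2 * (e * y j) ^ (1 + α))) := by
            field_simp
        _ = (K * M) ^ 2 * (C * b ^ j * y j ^ (1 + α)) := by
            rw [hsplit, hbe, hC]
            ring
    exact le_of_mul_le_mul_left hfinal (by positivity)
  have hy00 : y 0 ≤ δ := by
    have e1 : kk 0 = 0 := by simp [hkk]
    have e2 : rr 0 = R := by simp [hrr]
    simp only [hy, e1, e2]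
    rw [div_le_iff₀ (by positivity), mul_pow]
    refine h0.trans ?_
    nlinarith [sq_nonneg M]
  have hdecay := le_mul_pow_of_superlinear hy0 hCpos hb0 hα hδ0 hθ0 hbθ.le hCδ.le hy00 hstep
  have hlim : Tendsto (fun j : ℕ => (K * M) ^ 2 * (δ * θ ^ j)) atTop (𝓝 0) := by
    have := ((tendsto_pow_atTop_nhds_zero_of_lt_one hθ0.le hθ1).const_mul δ).const_mul ((K * M) ^ 2)
    simpa using this
  refine le_antisymm (ge_of_tendsto hlim (Eventually.of_forall fun j => ?_)) (ha _ _)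
  calc a (K * M) r ≤ a (kk j) (rr j) := hmono _ _ _ _ (hkkle j) (hrr0 j).le (hrrR j)
    _ = (K * M) ^ 2 * y j := hya j
    _ ≤ (K * M) ^ 2 * (δ * θ ^ j) := by
      gcongr
      exact hdecay j

/-! ### Boundedness of weak solutions -/

theorem sq_mul_measureReal_le_setIntegral {α : Type*} [MeasurableSpace α] {μ : Measure α}
    {B : Set α} {u : α → ℝ} (hB : MeasurableSet B) (hBμ : μ B ≠ ⊤) (hu : Measurable u) {k l : ℝ}
    (hkl : k ≤ l)
    (hint : IntegrableOn (fun x => (max (u x - k) 0) ^ 2) B μ) :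
    (l - k) ^ 2 * μ.real (B ∩ {x | l < u x}) ≤ ∫ x in B, (max (u x - k) 0) ^ 2 ∂μ := by
  have hS : MeasurableSet (B ∩ {x | l < u x}) :=
    hB.inter (measurableSet_lt measurable_const hu)
  have hSμ : μ (B ∩ {x | l < u x}) ≠ ⊤ := measure_ne_top_of_subset Set.inter_subset_left hBμ
  calc (l - k) ^ 2 * μ.real (B ∩ {x | l < u x}) = ∫ _ in B ∩ {x | l < u x}, (l - k) ^ 2 ∂μ := by
        rw [setIntegral_const, smul_eq_mul, mul_comm]
    _ ≤ ∫ x in B ∩ {x | l < u x}, (max (u x - k) 0) ^ 2 ∂μ := by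
        refine setIntegral_mono_on (integrableOn_const hSμ)
          (hint.mono_set Set.inter_subset_left) hS fun x hx => ?_
        have : l < u x := hx.2
        exact pow_le_pow_left₀ (by linarith) ((by linarith : l - k ≤ u x - k).trans
          (le_max_left _ _)) 2
    _ ≤ _ := setIntegral_mono_set hint (Eventually.of_forall fun x => sq_nonneg _)
        Set.inter_subset_left.eventuallyLE

/-- The one-sided bound for weak solutions, with data in `L^(q/2)` and `L^q`. -/
theorem exists_ae_le_of_isWeakSolution {n : ℕ} (hn : 2 ≤ n) {q : ℝ} (hq : (n : ℝ) < q) {r R : ℝ}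
    (hr : 0 < r) (hrR : r < R) {lam L : ℝ} (hlam : 0 < lam) (hL : 0 < L) :
    ∃ K : ℝ, 0 < K ∧ ∀ (Lam : ℝ) (A : EuclideanSpace ℝ (Fin n) → Matrix (Fin n) (Fin n) ℝ)
      (f u : EuclideanSpace ℝ (Fin n) → ℝ)
      (F : EuclideanSpace ℝ (Fin n) → EuclideanSpace ℝ (Fin n)),
      IsUniformlyElliptic (Metric.ball 0 R) A lam Lam L →
      MemLp f (ENNReal.ofReal (q / 2)) (volume.restrict (Metric.ball 0 R)) →
      MemLp F (ENNReal.ofReal q) (volume.restrict (Metric.ball 0 R)) →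
      IsWeakSolution (Metric.ball 0 R) A f F u → ∀ M : ℝ, 0 < M →
      (eLpNorm u 2 (volume.restrict (Metric.ball 0 R))).toReal ≤ M →
      (eLpNorm f (ENNReal.ofReal (q / 2)) (volume.restrict (Metric.ball 0 R))).toReal ≤ M →
      (eLpNorm F (ENNReal.ofReal q) (volume.restrict (Metric.ball 0 R))).toReal ≤ M →
      ∀ᵐ x ∂(volume.restrict (Metric.ball 0 r)), u x ≤ K * M := by
  have hn0 : (0 : ℝ) < n := by
    have : (2 : ℝ) ≤ n := by exact_mod_cast hn
    linarith
  have hα : 0 < 1 / (n : ℝ) - 1 / q := sub_pos.2 (one_div_lt_one_div_of_lt hn0 hq)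
  obtain ⟨C₀, hC₀, hlevel⟩ := exists_levelSet_estimate hn hq R hlam hL
  obtain ⟨K, hK, hiter⟩ := exists_deGiorgi_level hα hC₀ hr hrR
  refine ⟨K, hK, fun Lam A f u₀ F hA hf hF hsol M hM hu₀M hfM hFM => ?_⟩
  obtain ⟨G₀, h₀, hweak₀⟩ := hsol
  -- Replace the solution and its gradient by strongly measurable representatives.
  obtain ⟨u, hu, hu₀u⟩ := h₀.memLp.aestronglyMeasurable
  obtain ⟨G, hG, hG₀G⟩ := h₀.memLp_grad.aestronglyMeasurable
  have h : HasH1Gradient (Metric.ball 0 R) u G := by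
    refine ⟨h₀.memLp.ae_eq hu₀u, h₀.memLp_grad.ae_eq hG₀G, fun φ hφ i => ?_⟩
    have e1 : ∫ x in Metric.ball 0 R, u x * gradient φ x i
        = ∫ x in Metric.ball 0 R, u₀ x * gradient φ x i :=
      integral_congr_ae (hu₀u.mono fun x hx => by simp only [hx])
    have e2 : ∫ x in Metric.ball 0 R, G x i * φ x = ∫ x in Metric.ball 0 R, G₀ x i * φ x :=
      integral_congr_ae (hG₀G.mono fun x hx => by simp only [hx])
    rw [e1, e2]
    exact h₀.integral_eq φ hφ i
  have hweak : ∀ v V, HasH10Gradient (Metric.ball 0 R) v V →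
      ∫ x in Metric.ball 0 R, (A x *ᵥ (G x).ofLp) ⬝ᵥ (V x).ofLp =
        (∫ x in Metric.ball 0 R, f x * v x) - ∫ x in Metric.ball 0 R, inner ℝ (F x) (V x) := by
    intro v V hv
    rw [← hweak₀ v V hv]
    exact integral_congr_ae (hG₀G.mono fun x hx => by simp only [hx])
  rw [eLpNorm_congr_ae hu₀u] at hu₀M
  have hwm : ∀ k, StronglyMeasurable (fun x => max (u x - k) 0) := fun k =>
    (hu.sub stronglyMeasurable_const).sup stronglyMeasurable_const
  have : IsFiniteMeasure (volume.restrict (Metric.ball (0 : EuclideanSpace ℝ (Fin n)) R)) :=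
    ⟨by
      rw [Measure.restrict_apply_univ]
      exact measure_ball_lt_top⟩
  have hint : ∀ k, IntegrableOn (fun x => (max (u x - k) 0) ^ 2) (Metric.ball 0 R) volume := by
    intro k
    refine MemLp.integrable_sq (((h.memLp.sub (memLp_const k)).norm).of_le
      (hwm k).aestronglyMeasurable (Eventually.of_forall fun x => ?_))
    rw [norm_norm, Real.norm_of_nonneg (le_max_right _ _)]
    exact max_le (le_abs_self _) (abs_nonneg _)
  have hzero := hiter (fun k ρ => ∫ x in Metric.ball 0 ρ, (max (u x - k) 0) ^ 2)
    (fun k ρ => volume.real (Metric.ball 0 ρ ∩ {x | k < u x})) M hM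
    (fun k ρ => integral_nonneg fun _ => sq_nonneg _) (fun k ρ => measureReal_nonneg)
    (fun k l ρ σ hkl hρσ hσR => ?_) (fun k l σ hkl hσR => ?_) (fun k ρ σ hρ hρσ hσR => ?_) ?_
  · have hintr := (hint (K * M)).mono_set (Metric.ball_subset_ball hrR.le)
    have h2 := (integral_eq_zero_iff_of_nonneg (fun _ => sq_nonneg _) hintr).1 hzero
    have hu₀r := ae_restrict_of_ae_restrict_of_subset (Metric.ball_subset_ball hrR.le) hu₀u
    filter_upwards [h2, hu₀r] with x hx hx'
    rw [hx']
    have h3 : max (u x - K * M) 0 = 0 := by simpa using hx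
    linarith [le_max_left (u x - K * M) 0]
  · refine (integral_mono ((hint l).mono_set (Metric.ball_subset_ball (hρσ.trans hσR)))
      ((hint k).mono_set (Metric.ball_subset_ball (hρσ.trans hσR))) fun x => ?_).trans
      (setIntegral_mono_set ((hint k).mono_set (Metric.ball_subset_ball hσR))
        (Eventually.of_forall fun x => sq_nonneg _) (Metric.ball_subset_ball hρσ).eventuallyLE)
    exact pow_le_pow_left₀ (le_max_right _ _) (max_le_max (by linarith) le_rfl) 2
  · exact sq_mul_measureReal_le_setIntegral Metric.isOpen_ball.measurableSet
      measure_ball_lt_top.ne hu.measurable hkl.le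
      ((hint k).mono_set (Metric.ball_subset_ball hσR))
  · refine (hlevel Lam A f u F G hA hf hF h hu hG hweak k ρ σ hρ hρσ hσR).trans ?_
    gcongr
    have e1 := pow_le_pow_left₀ ENNReal.toReal_nonneg hfM 2
    have e2 := pow_le_pow_left₀ ENNReal.toReal_nonneg hFM 2
    linarith
  · have e1 := pow_le_pow_left₀ ENNReal.toReal_nonneg hu₀M 2
    rw [toReal_eLpNorm_two_sq hu.aestronglyMeasurable] at e1
    refine le_trans (integral_mono (hint 0)
      (h.memLp.integrable_norm_pow two_ne_zero) fun x => ?_) e1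
    dsimp only
    rw [sub_zero, Real.norm_eq_abs]
    exact pow_le_pow_left₀ (le_max_right _ _) (max_le (le_abs_self _) (abs_nonneg _)) 2

theorem IsWeakSolution.neg {n : ℕ} {Ω : Set (EuclideanSpace ℝ (Fin n))}
    {A : EuclideanSpace ℝ (Fin n) → Matrix (Fin n) (Fin n) ℝ}
    {f u : EuclideanSpace ℝ (Fin n) → ℝ}
    {F : EuclideanSpace ℝ (Fin n) → EuclideanSpace ℝ (Fin n)} (h : IsWeakSolution Ω A f F u) :
    IsWeakSolution Ω A (-f) (-F) (-u) := by
  obtain ⟨G, hG, hweak⟩ := h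
  refine ⟨-G, ⟨hG.memLp.neg, hG.memLp_grad.neg, fun φ hφ i => ?_⟩, fun v V hv => ?_⟩
  · have := hG.integral_eq φ hφ i
    simp only [Pi.neg_apply, PiLp.neg_apply, neg_mul, integral_neg]
    rw [this]
  · have := hweak v V hv
    simp only [Pi.neg_apply, WithLp.ofLp_neg, Matrix.mulVec_neg, neg_dotProduct, neg_mul,
      inner_neg_left, integral_neg]
    linarith

/-- Hölder's inequality on a set of finite positive measure, as the comparison of two `L^p` norms
with a finite constant. -/
theorem exists_eLpNorm_le_mul_eLpNorm {α F : Type*} [MeasurableSpace α] [NormedAddCommGroup F]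
    (μ : Measure α) (hμ : μ Set.univ ≠ 0) [IsFiniteMeasure μ] {p q : ℝ≥0∞} (hpq : p ≤ q) :
    ∃ c : ℝ, 0 ≤ c ∧ ∀ f : α → F, AEStronglyMeasurable f μ →
      eLpNorm f p μ ≤ ENNReal.ofReal c * eLpNorm f q μ := by
  have htop : μ Set.univ ^ (1 / p.toReal - 1 / q.toReal) ≠ ⊤ :=
    ENNReal.rpow_ne_top_of_ne_zero hμ (measure_ne_top _ _)
  refine ⟨(μ Set.univ ^ (1 / p.toReal - 1 / q.toReal)).toReal, ENNReal.toReal_nonneg,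
    fun f hf => ?_⟩
  rw [ENNReal.ofReal_toReal htop, mul_comm]
  exact eLpNorm_le_eLpNorm_mul_rpow_measure_univ hpq hf

theorem mainTheorem6 (n : ℕ) (hn : 2 ≤ n) (p q : ℝ≥0∞)
    (hp : (n : ℝ≥0∞) / 2 < p) (hq : (n : ℝ≥0∞) < q)
    (r R : ℝ) (hr : 0 < r) (hrR : r < R) (hR : R ≤ 1)
    (lam Lam L : ℝ) (hlam : 0 < lam) (hLam : lam ≤ Lam) (hL : 0 < L) :
    ∃ C : ℝ, 0 < C ∧
      ∀ (A : EuclideanSpace ℝ (Fin n) → Matrix (Fin n) (Fin n) ℝ)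
        (f : EuclideanSpace ℝ (Fin n) → ℝ)
        (F : EuclideanSpace ℝ (Fin n) → EuclideanSpace ℝ (Fin n))
        (u : EuclideanSpace ℝ (Fin n) → ℝ),
        IsUniformlyElliptic (Metric.ball 0 R) A lam Lam L →
        MemLp f p (volume.restrict (Metric.ball 0 R)) →
        MemLp F q (volume.restrict (Metric.ball 0 R)) →
        IsWeakSolution (Metric.ball 0 R) A f F u →
        eLpNorm u ∞ (volume.restrict (Metric.ball 0 r)) ≤
          ENNReal.ofReal C *
            (eLpNorm u 2 (volume.restrict (Metric.ball 0 R)) +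
              eLpNorm f p (volume.restrict (Metric.ball 0 R)) +
              eLpNorm F q (volume.restrict (Metric.ball 0 R))) := by
  -- A finite exponent `q₀ > n` with `q₀ ≤ q` and `q₀ / 2 ≤ p`.
  have hp2 : (n : ℝ≥0∞) < p * 2 :=
    (ENNReal.div_lt_iff (Or.inl two_ne_zero) (Or.inl ENNReal.ofNat_ne_top)).1 hp
  obtain ⟨q₀, hnq₀, hq₀⟩ := ENNReal.lt_iff_exists_nnreal_btwn.1 (lt_min hq hp2)
  have hnq : (n : ℝ) < q₀ := by exact_mod_cast hnq₀
  have hqle : ENNReal.ofReal (q₀ : ℝ) ≤ q := by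
    rw [ENNReal.ofReal_coe_nnreal]
    exact (hq₀.trans_le (min_le_left _ _)).le
  have hple : ENNReal.ofReal ((q₀ : ℝ) / 2) ≤ p := by
    rw [ENNReal.ofReal_div_of_pos two_pos, ENNReal.ofReal_coe_nnreal, ENNReal.ofReal_ofNat]
    exact ENNReal.div_le_of_le_mul (hq₀.trans_le (min_le_right _ _)).le
  set μ := (volume.restrict (Metric.ball (0 : EuclideanSpace ℝ (Fin n)) R)) with hμ
  have : IsFiniteMeasure μ := ⟨by
    rw [hμ, Measure.restrict_apply_univ]
    exact measure_ball_lt_top⟩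
  have hμ0 : μ Set.univ ≠ 0 := by
    rw [hμ, Measure.restrict_apply_univ]
    exact (Metric.measure_ball_pos _ _ (hr.trans hrR)).ne'
  obtain ⟨cf, hcf0, hcf⟩ := exists_eLpNorm_le_mul_eLpNorm (F := ℝ) μ hμ0 hple
  obtain ⟨cF, hcF0, hcF⟩ :=
    exists_eLpNorm_le_mul_eLpNorm (F := EuclideanSpace ℝ (Fin n)) μ hμ0 hqle
  obtain ⟨K, hK, hbound⟩ := exists_ae_le_of_isWeakSolution hn hnq hr hrR hlam hL
  refine ⟨K * (1 + cf + cF), by positivity, fun A f F u hA hf hF hsol => ?_⟩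
  have hu : MemLp u 2 μ := by
    obtain ⟨G, hG, -⟩ := hsol
    exact hG.memLp
  have hf' := hf.mono_exponent hple
  have hF' := hF.mono_exponent hqle
  set E := eLpNorm u 2 μ + eLpNorm f p μ + eLpNorm F q μ with hE
  have hEtop : E ≠ ⊤ := ENNReal.add_ne_top.2
    ⟨ENNReal.add_ne_top.2 ⟨hu.eLpNorm_ne_top, hf.eLpNorm_ne_top⟩, hF.eLpNorm_ne_top⟩
  have hle : ∀ {N N' : ℝ≥0∞} {c : ℝ}, 0 ≤ c → N ≤ ENNReal.ofReal c * N' → N' ≤ E →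
      N.toReal ≤ c * E.toReal := by
    intro N N' c hc h1 h2
    have h3 := ENNReal.toReal_mono (ENNReal.mul_ne_top ENNReal.ofReal_ne_top hEtop)
      (h1.trans (by gcongr))
    rwa [ENNReal.toReal_mul, ENNReal.toReal_ofReal hc] at h3
  have hE0 : 0 ≤ E.toReal := ENNReal.toReal_nonneg
  have n1 : (eLpNorm u 2 μ).toReal ≤ 1 * E.toReal :=
    hle zero_le_one (by simp) (le_self_add.trans le_self_add)
  have n2 := hle hcf0 (hcf f hf.aestronglyMeasurable) (le_add_self.trans le_self_add)
  have n3 := hle hcF0 (hcF F hF.aestronglyMeasurable) le_add_self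
  have hcfE := mul_nonneg hcf0 hE0
  have hcFE := mul_nonneg hcF0 hE0
  -- The iteration needs a positive bound for the data, which may vanish.
  have key : ∀ ε : ℝ, 0 < ε → eLpNorm u ∞ (volume.restrict (Metric.ball 0 r)) ≤
      ENNReal.ofReal (K * ((1 + cf + cF) * E.toReal + ε)) := by
    intro ε hε
    set M := (1 + cf + cF) * E.toReal + ε with hM
    have hMeq : M = E.toReal + cf * E.toReal + cF * E.toReal + ε := by
      rw [hM]
      ring
    have hM0 : 0 < M := by linarith
    have b1 := hbound Lam A f u F hA hf' hF' hsol M hM0 (by linarith) (by linarith) (by linarith)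
    have b2 := hbound Lam A (-f) (-u) (-F) hA hf'.neg hF'.neg hsol.neg M hM0
      (by rw [eLpNorm_neg]; linarith) (by rw [eLpNorm_neg]; linarith)
      (by rw [eLpNorm_neg]; linarith)
    rw [eLpNorm_exponent_top]
    refine eLpNormEssSup_le_of_ae_bound ?_
    filter_upwards [b1, b2] with x h1 h2
    rw [Real.norm_eq_abs, abs_le]
    simp only [Pi.neg_apply] at h2
    constructor <;> linarith
  have hlim : Tendsto (fun ε : ℝ => ENNReal.ofReal (K * ((1 + cf + cF) * E.toReal + ε)))
      (𝓝[>] 0) (𝓝 (ENNReal.ofReal (K * ((1 + cf + cF) * E.toReal + 0)))) :=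
    (ENNReal.continuous_ofReal.comp (by fun_prop)).continuousAt.tendsto.mono_left
      nhdsWithin_le_nhds
  have hfinal := ge_of_tendsto hlim (eventually_nhdsWithin_of_forall key)
  rwa [add_zero, ← mul_assoc, ENNReal.ofReal_mul (by positivity), ENNReal.ofReal_toReal hEtop]
    at hfinal
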